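/- Throughout, $\mathbb N=\{0,1,2,\dots\}$, $1\le p<\infty$, and $(e_k)_{k\ge 0}$ is the canonical basis of the complex space $\ell_p(\mathbb N)$. A bounded operator $T$ on a complex Banach space $X$ is *hypercyclic* if it has a dense orbit, *chaotic* if it is hypercyclic and its periodic points are dense, and *frequently hypercyclic* (resp. *$\mathcal U$-frequently hypercyclic*) if there is $x\in X$ such that for every non-empty open $V\subseteq X$ the set $\{i\in\mathbb N: T^ix\in V\}$ has positive lower (resp. upper) density. **Operators of C-type.** Let $v=(v_n)_{n\ge1}$ be non-zero complex numbers with $\sum_n|v_n|<\infty$; let $w=(w_j)_{j\ge1}$ be complex numbers with $0<\inf_j|w_j|\le\sup_j|w_j|<\infty$; let $\varphi:\mathbb N\to\mathbb N$ satisfy $\varphi(0)=0$, $\varphi(n)<n$ for $n\ge1$, with $\varphi^{-1}(l)$ infinite for every $l$; let $b=(b_n)_{n\ge0}$ be a strictly increasing sequence of integers with $b_0=0$ such that $b_{n+1}-b_n$ is a multiple of $2(b_{\varphi(n)+1}-b_{\varphi(n)})$ for every $n\ge1$; and assume $\inf_{n\ge0}\prod_{b_n<j<b_{n+1}}|w_j|>0$.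 The operator of C-type $T=T_{v,w,\varphi,b}$ on $\ell_p(\mathbb N)$ is the bounded operator with $$Te_k=\begin{cases} w_{k+1}e_{k+1} & \text{if } k\in[b_n,b_{n+1}-1),\ n\ge0,\\ v_ne_{b_{\varphi(n)}}-\Bigl(\prod_{j=b_n+1}^{b_{n+1}-1}w_j\Bigr)^{-1}e_{b_n} & \text{if } k=b_{n+1}-1,\ n\ge1,\\ -\Bigl(\prod_{j=1}^{b_1-1}w_j\Bigr)^{-1}e_0 & \text{if } k=b_1-1.\end{cases}$$ It is *of C$_{+,2}$-type*, with associated integer sequences $(\tau^{(k)})_{k\ge1}$, $(\delta^{(k)})_{k\ge1}$, $(\Delta^{(k)})_{k\ge1}$, where $(\tau^{(k)})$ and $(\delta^{(k)})$ are strictly increasing, $\delta^{(k)}\ge0$ and $4\delta^{(k)}<\Delta^{(k)}$, if for every $k\ge1$ and every $n\in[2^{k-1},2^k)$: $\varphi(n)=n-2^{k-1}$, $b_{n+1}-b_n=\Delta^{(k)}$, $v_n=2^{-\tau^{(k)}}$, and for $1\le i<\Delta^{(k)}$ $$w_{b_n+i}=\begin{cases}2&\text{if }1\le i\le\delta^{(k)},\\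 1&\text{if }\delta^{(k)}<i<\Delta^{(k)}-3\delta^{(k)},\\ 1/2&\text{if }\Delta^{(k)}-3\delta^{(k)}\le i<\Delta^{(k)}-2\delta^{(k)},\\ 2&\text{if }\Delta^{(k)}-2\delta^{(k)}\le i<\Delta^{(k)}-\delta^{(k)},\\ 1&\text{if }\Delta^{(k)}-\delta^{(k)}\le i<\Delta^{(k)}.\end{cases}$$ **Theorem.** (1) Consider parameters of C$_{+,2}$-type, let $\delta^{(0)}\ge 0$ be any integer, and set $\gamma_k:=2^{\delta^{(k-1)}-\tau^{(k)}}\bigl(\Delta^{(k)}\bigr)^{1-1/p}$ for $k\ge1$. Suppose that $(\gamma_k)_{k\ge1}$ is non-increasing and that $$\sum_{k\ge1}2^k\gamma_k^{1/2}\le1,\qquad \limsup_{k\to\infty}\frac{\tau^{(k)}}{\delta^{(k)}}<1,\qquad \lim_{k\to\infty}\frac{\delta^{(k)}}{\delta^{(k+1)}}=0,\qquad \lim_{k\to\infty}\frac{\delta^{(k)}}{\Delta^{(k)}}=0.$$ Then the operator $T=T_{v,w,\varphi,b}$ is well defined and bounded on $\ell_p(\mathbb N)$ (there is exactly one bounded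 operator acting on the basis as above), and $T$ is chaotic and $\mathcal U$-frequently hypercyclic but not frequently hypercyclic. (2) There is an integer $C_0$ such that for every integer $C\ge C_0$ there exist parameters of C$_{+,2}$-type with $$\tau^{(k)}=2^{Ck^2},\qquad \delta^{(k)}=2^{Ck^2+1},\qquad \Delta^{(k)}=2^{2Ck^2+4}\qquad(k\ge1),$$ and for any such parameters and any $1\le p<\infty$ the associated operator on $\ell_p(\mathbb N)$ is well defined, bounded, chaotic and $\mathcal U$-frequently hypercyclic but not frequently hypercyclic. (3) Consequently, every infinite-dimensional separable complex Hilbert space carries a bounded operator that is chaotic and $\mathcal U$-frequently hypercyclic but not frequently hypercyclic. -/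

import Mathlib

open Filter Topology
open scoped ENNReal

noncomputable section

/-! ### Linear dynamics -/

/-- Lower density of a set of natural numbers. -/
def lowerDensity (A : Set ℕ) : ℝ :=
  liminf (fun n : ℕ => ((A ∩ Set.Iic n).ncard : ℝ) / ((n : ℝ) + 1)) atTop

/-- Upper density of a set of natural numbers. -/
def upperDensity (A : Set ℕ) : ℝ :=
  limsup (fun n : ℕ => ((A ∩ Set.Iic n).ncard : ℝ) / ((n : ℝ) + 1)) atTop

/-- The set of times at which the orbit of `x` under `T` visits `V`. -/
def visitTimes {X : Type*} (T : X → X) (x : X) (V : Set X) : Set ℕ :=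
  {i : ℕ | T^[i] x ∈ V}

/-- `T` admits a dense orbit. -/
def IsHypercyclic {X : Type*} [NormedAddCommGroup X] [NormedSpace ℂ X] (T : X →L[ℂ] X) : Prop :=
  ∃ x : X, Dense (Set.range fun n : ℕ => (⇑T)^[n] x)

/-- `T` is hypercyclic and has a dense set of periodic points. -/
def IsChaotic {X : Type*} [NormedAddCommGroup X] [NormedSpace ℂ X] (T : X →L[ℂ] X) : Prop :=
  IsHypercyclic T ∧ Dense (Function.periodicPts ⇑T)

/-- `T` is frequently hypercyclic. -/
def IsFrequentlyHypercyclic {X : Type*} [NormedAddCommGroup X] [NormedSpace ℂ X]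
    (T : X →L[ℂ] X) : Prop :=
  ∃ x : X, ∀ V : Set X, IsOpen V → V.Nonempty → 0 < lowerDensity (visitTimes (⇑T) x V)

/-- `T` is `𝒰`-frequently hypercyclic. -/
def IsUFrequentlyHypercyclic {X : Type*} [NormedAddCommGroup X] [NormedSpace ℂ X]
    (T : X →L[ℂ] X) : Prop :=
  ∃ x : X, ∀ V : Set X, IsOpen V → V.Nonempty → 0 < upperDensity (visitTimes (⇑T) x V)

/-! ### Operators of C-type -/

/-- The parameters `v`, `w`, `φ`, `b` of an operator of C-type.  The values `v 0` and `w 0` play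
no role. -/
structure CTypeData where
  /-- the perturbation coefficients `v n`, `n ≥ 1` -/
  v : ℕ → ℂ
  /-- the weights `w j`, `j ≥ 1` -/
  w : ℕ → ℂ
  /-- the map between blocks -/
  φ : ℕ → ℕ
  /-- the block end points: the `n`-th block is `[b n, b (n + 1))` -/
  b : ℕ → ℕ
  v_ne_zero : ∀ n, 1 ≤ n → v n ≠ 0
  v_summable : Summable fun n : ℕ => ‖v (n + 1)‖
  w_bounded : ∃ M : ℝ, ∀ j, 1 ≤ j → ‖w j‖ ≤ M
  w_bounded_below : ∃ m : ℝ, 0 < m ∧ ∀ j, 1 ≤ j → m ≤ ‖w j‖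
  φ_zero : φ 0 = 0
  φ_lt : ∀ n, 1 ≤ n → φ n < n
  φ_fiber_infinite : ∀ l, {n : ℕ | φ n = l}.Infinite
  b_zero : b 0 = 0
  b_strictMono : StrictMono b
  b_dvd : ∀ n, 1 ≤ n → 2 * (b (φ n + 1) - b (φ n)) ∣ b (n + 1) - b n
  prod_bounded_below : ∃ c : ℝ, 0 < c ∧ ∀ n, c ≤ ∏ j ∈ Finset.Ioo (b n) (b (n + 1)), ‖w j‖

namespace CTypeData

/-- The product of all the weights `w j`, `b n < j < b (n + 1)`. -/
def blockProd (d : CTypeData) (n : ℕ) : ℂ :=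
  ∏ j ∈ Finset.Ioo (d.b n) (d.b (n + 1)), d.w j

/-- `T` is the operator of C-type with parameters `d` on `ℓ_p(ℕ)`: it is the bounded operator
acting on the canonical basis `e_k = lp.single p k 1` in the prescribed way. -/
structure IsOperator (d : CTypeData) (p : ℝ≥0∞) [Fact (1 ≤ p)]
    (T : lp (fun _ : ℕ => ℂ) p →L[ℂ] lp (fun _ : ℕ => ℂ) p) : Prop where
  apply_inner : ∀ n k, d.b n ≤ k → k + 1 < d.b (n + 1) →
    T (lp.single p k 1) = d.w (k + 1) • lp.single p (k + 1) 1
  apply_last : ∀ n, 1 ≤ n →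
    T (lp.single p (d.b (n + 1) - 1) 1) =
      d.v n • lp.single p (d.b (d.φ n)) 1 - (d.blockProd n)⁻¹ • lp.single p (d.b n) 1
  apply_last_zero :
    T (lp.single p (d.b 1 - 1) 1) = -((d.blockProd 0)⁻¹ • lp.single p 0 1)

/-- The parameters `d` are of C₊-type, with block lengths `Δ k`, coefficients `vk k` and weights
`wk k i` (`1 ≤ i < Δ k`) on the blocks number `n ∈ [2 ^ (k - 1), 2 ^ k)`, `k ≥ 1`. -/
structure IsCPlusType (d : CTypeData) (Δ : ℕ → ℕ) (vk : ℕ → ℂ) (wk : ℕ → ℕ → ℂ) : Prop where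
  φ_eq : ∀ k, 1 ≤ k → ∀ n, 2 ^ (k - 1) ≤ n → n < 2 ^ k → d.φ n = n - 2 ^ (k - 1)
  b_eq : ∀ k, 1 ≤ k → ∀ n, 2 ^ (k - 1) ≤ n → n < 2 ^ k → d.b (n + 1) - d.b n = Δ k
  v_eq : ∀ k, 1 ≤ k → ∀ n, 2 ^ (k - 1) ≤ n → n < 2 ^ k → d.v n = vk k
  w_eq : ∀ k, 1 ≤ k → ∀ n, 2 ^ (k - 1) ≤ n → n < 2 ^ k →
    ∀ i, 1 ≤ i → i < Δ k → d.w (d.b n + i) = wk k i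

/-- The weight number `i` (`1 ≤ i < D`) in a block of length `D` of an operator of C₊,₂-type with
parameter `s` (where `4 * s < D`). -/
def cPlus2Weight (s D i : ℕ) : ℂ :=
  if i ≤ s then 2
  else if i + 3 * s < D then 1
  else if i + 2 * s < D then 1 / 2
  else if i + s < D then 2
  else 1

/-- The parameters `d` are of C₊,₂-type, with associated sequences `τ k`, `δ k`, `Δ k`, `k ≥ 1`
(the values at `k = 0` play no role). -/
structure IsCPlus2Type (d : CTypeData) (τ : ℕ → ℤ) (δ Δ : ℕ → ℕ) : Prop where
  isCPlusType : d.IsCPlusType Δ (fun k => (2 : ℂ) ^ (-τ k)) (fun k i => cPlus2Weight (δ k) (Δ k) i)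
  τ_strictMono : StrictMonoOn τ (Set.Ici 1)
  δ_strictMono : StrictMonoOn δ (Set.Ici 1)
  four_mul_lt : ∀ k, 1 ≤ k → 4 * δ k < Δ k

end CTypeData

/-- `γ_k = 2 ^ (δ_{k-1} - τ_k) * Δ_k ^ (1 - 1 / p)`, to be used for `k ≥ 1`. -/
def gammaSeq (p : ℝ≥0∞) (τ : ℕ → ℤ) (δ Δ : ℕ → ℕ) (k : ℕ) : ℝ :=
  (2 : ℝ) ^ ((δ (k - 1) : ℤ) - τ k) * (Δ k : ℝ) ^ (1 - 1 / p.toReal)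

end

/-!
The basis vectors are grouped into blocks. On each block `T` is a weighted cyclic shift, up to a
sign, and at the end of a turn in the `n`-th block (`n ≥ 1`) a fraction `v n` leaks to the lower
block number `φ n`. By the divisibility assumption on the lengths, what is leaked in two consecutive
turns cancels (`IsOperator.pow_two_mul_len_apply_start`), so every finitely supported vector is
periodic. `T` itself is the sum of the cyclic shifts and of a nuclear operator.

In a block of level `k` (that is, `2 ^ (k - 1) ≤ n < 2 ^ k`) the product of the first `q` weights is
`2 ^ height q`, where `height` rises to `δ k`, stays there, falls to `0` and rises to `δ k` again
shortly before the end, with a final stretch of length `δ k` where it is constant.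

*`𝒰`-frequent hypercyclicity.* A vector that starts in the valley, about `2 δ k` steps before the end
of its block, is amplified by `2 ^ δ k` before it leaks with coefficient `2 ^ (-τ k)`. As `τ k` is
smaller than `δ k` by a factor, a tiny vector produces at time `2 δ k` any prescribed finitely
supported vector, while the part remaining in the block stays small for a time proportional to
`δ k` (`IsCPlus2Type.exists_approx`). Together with periodicity and Baire's theorem this gives
visits with positive upper density (`isUFrequentlyHypercyclic_of_periodic`).

*Failure of frequent hypercyclicity.* Let `V` consist of the vectors of moderate norm with a large
coordinate number `0`. An orbit that starts at a tiny vector can visit `V` by the time `J` only if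
some block has leaked significantly. Consider the last such block, of level `k`. The mass that
leaks spends most of each turn, of length `Δ k` much larger than `δ k`, at positions of maximal
height, where it is larger than its trace in the lower blocks by a factor of order `1 / γ k`; since
the following blocks have not interfered, the orbit is outside `V` at those times. A Markov
inequality over the coordinates of the block leaves at most of the order of `δ k * (J / Δ k + 2)`
visits up to time `J` (`IsCPlus2Type.card_le_of_leak`). Finally a block of level `k` leaks nothing
significant up to time `δ k`, because of the final flat stretch, so at the times `J = K * δ k`, which
are less than `δ (k + 1)`, only levels up to `k` matter, and the proportion of visits is small for
large `K` (`IsCPlus2Type.card_visits_le`).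

For Hilbert spaces the operator on `ℓ_2(ℕ)` is conjugated by a Hilbert basis indexed by `ℕ`.
-/

/-! ### Densities and the dynamical properties -/

theorem ncard_inter_Iic_le (A : Set ℕ) (n : ℕ) : (A ∩ Set.Iic n).ncard ≤ n + 1 := by
  calc (A ∩ Set.Iic n).ncard ≤ (Set.Iic n).ncard :=
        Set.ncard_le_ncard Set.inter_subset_right (Set.finite_Iic n)
    _ = n + 1 := by
      rw [← Finset.coe_Iic, Set.ncard_coe_finset, Nat.card_Iic]

theorem ncard_inter_Iic_div_le_one (A : Set ℕ) (n : ℕ) :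
    ((A ∩ Set.Iic n).ncard : ℝ) / ((n : ℝ) + 1) ≤ 1 := by
  rw [div_le_one (by positivity)]
  exact_mod_cast ncard_inter_Iic_le A n

theorem upperDensity_empty : upperDensity ∅ = 0 := by
  simp [upperDensity]

theorem le_upperDensity {A : Set ℕ} {c : ℝ}
    (h : ∃ᶠ n : ℕ in atTop, c * ((n : ℝ) + 1) ≤ ((A ∩ Set.Iic n).ncard : ℝ)) :
    c ≤ upperDensity A := by
  refine le_limsup_of_frequently_le (h.mono fun n hn => ?_)
    (isBoundedUnder_of ⟨1, ncard_inter_Iic_div_le_one A⟩)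
  rwa [le_div_iff₀ (by positivity)]

theorem exists_eventually_of_lowerDensity_pos {A : Set ℕ} (h : 0 < lowerDensity A) :
    ∃ c : ℝ, 0 < c ∧ ∀ᶠ n : ℕ in atTop, c * ((n : ℝ) + 1) ≤ ((A ∩ Set.Iic n).ncard : ℝ) := by
  obtain ⟨c, hc0, hc⟩ := exists_between h
  refine ⟨c, hc0, (eventually_lt_of_lt_liminf hc (isBoundedUnder_of ⟨0, fun n => ?_⟩)).mono
    fun n hn => ?_⟩
  · positivity
  · rw [lt_div_iff₀ (by positivity)] at hn
    exact hn.le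

theorem lowerDensity_pos_nonempty {A : Set ℕ} (h : 0 < lowerDensity A) : A.Nonempty := by
  by_contra hA
  rw [Set.not_nonempty_iff_eq_empty] at hA
  subst hA
  simp [lowerDensity] at h

section Dynamics

variable {X : Type*} [NormedAddCommGroup X] [NormedSpace ℂ X]

theorem iterate_eq_pow (T : X →L[ℂ] X) (n : ℕ) (x : X) : (⇑T)^[n] x = (T ^ n) x := by
  rw [FunLike.coe_pow_eq_iterate]

theorem pow_apply_of_dvd {T : X →L[ℂ] X} {x : X} {D : ℕ} (h : (T ^ D) x = x) {k : ℕ}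
    (hk : D ∣ k) : (T ^ k) x = x := by
  obtain ⟨j, rfl⟩ := hk
  induction j with
  | zero => simp
  | succ j ih => rw [Nat.mul_succ, pow_add, mul_apply_eq_comp, h, ih]

theorem pow_mod_apply {T : X →L[ℂ] X} {x : X} {D : ℕ} (h : (T ^ D) x = x) (k : ℕ) :
    (T ^ (k % D)) x = (T ^ k) x := by
  conv_rhs => rw [← Nat.mod_add_div k D, pow_add, mul_apply_eq_comp,
    pow_apply_of_dvd h (dvd_mul_right _ _)]

theorem exists_norm_pow_apply_le {T : X →L[ℂ] X} {x : X} {D : ℕ} (hD : 0 < D)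
    (h : (T ^ D) x = x) : ∃ M : ℝ, ∀ k, ‖(T ^ k) x‖ ≤ M := by
  refine ⟨∑ i ∈ Finset.range D, ‖(T ^ i) x‖, fun k => ?_⟩
  rw [← pow_mod_apply h k]
  exact Finset.single_le_sum (f := fun i => ‖(T ^ i) x‖) (fun i _ => norm_nonneg _)
    (Finset.mem_range.2 (Nat.mod_lt k hD))

theorem IsUFrequentlyHypercyclic.isHypercyclic {T : X →L[ℂ] X}
    (h : IsUFrequentlyHypercyclic T) : IsHypercyclic T := by
  obtain ⟨x, hx⟩ := h
  refine ⟨x, dense_iff_inter_open.2 fun U hU hne => ?_⟩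
  by_contra hcon
  have : visitTimes (⇑T) x U = ∅ := by
    ext i
    simp only [visitTimes, Set.mem_ofPred_eq, Set.mem_empty_iff_false, iff_false]
    exact fun hi => hcon ⟨_, hi, i, rfl⟩
  have := this ▸ hx U hU hne
  rw [upperDensity_empty] at this
  exact lt_irrefl _ this

/-- A Baire category criterion for `𝒰`-frequent hypercyclicity of an operator whose periodic
points contain a dense subspace `X₀`: arbitrarily small perturbations `z` of `0` reach a
neighbourhood of any prescribed `x ∈ X₀` at suitable times `m`, and then follow the orbit of `x`
during a time proportional to `m`. -/
theorem isUFrequentlyHypercyclic_of_periodic [CompleteSpace X]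
    [TopologicalSpace.SeparableSpace X] (T : X →L[ℂ] X) (X₀ : Submodule ℂ X)
    (hdense : Dense (X₀ : Set X)) (hper : ∀ x ∈ X₀, x ∈ Function.periodicPts ⇑T)
    {α : ℝ} (hα : 0 < α)
    (h : ∀ x ∈ X₀, ∀ D : ℕ, 0 < D → ∀ ε : ℝ, 0 < ε → ∀ N : ℕ, ∃ z : X, ∃ m : ℕ, N ≤ m ∧ D ∣ m ∧
      ‖z‖ < ε ∧ ∀ r : ℕ, (r : ℝ) ≤ α * m → ‖(T ^ (m + r)) z - (T ^ r) x‖ < ε) :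
    IsUFrequentlyHypercyclic T := by
  classical
  obtain ⟨t, htX, htc, htd⟩ := hdense.exists_countable_dense_subset
  have : Countable t := htc.to_subtype
  have hper' : ∀ x : X, ∃ D : ℕ, x ∈ X₀ → 0 < D ∧ (T ^ D) x = x := by
    intro x
    by_cases hx : x ∈ X₀
    · obtain ⟨D, hD, hDx⟩ := hper x hx
      refine ⟨D, fun _ => ⟨hD, ?_⟩⟩
      rw [← iterate_eq_pow]
      exact hDx
    · exact ⟨0, fun h => absurd h hx⟩
  choose P hP using hper'
  have hmul : ∀ x ∈ X₀, ∀ k, P x ∣ k → (T ^ k) x = x := fun x hx k hk =>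
    pow_apply_of_dvd (hP x hx).2 hk
  -- the density of visits that is reached near the target `u`
  set c : X → ℝ := fun u => α / (P u * (2 + α)) with hc
  -- the vectors that visit the ball of radius `1 / (i + 1)` about `u` with density at least `c u`
  -- up to some time `n ≥ N`, where `q = (u, i, N)`
  let G : t × ℕ × ℕ → Set X := fun q =>
    ⋃ n ≥ q.2.2, ⋃ F ∈ {F : Finset ℕ | F ⊆ Finset.range (n + 1) ∧ c q.1 * ((n : ℝ) + 1) ≤ F.card},
      ⋂ j ∈ F, (T ^ j) ⁻¹' Metric.ball (q.1 : X) (1 / ((q.2.1 : ℝ) + 1))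
  have hGo : ∀ q, IsOpen (G q) := by
    intro q
    refine isOpen_iUnion fun n => isOpen_iUnion fun _ => isOpen_iUnion fun F =>
      isOpen_iUnion fun _ => isOpen_biInter_finset fun j _ => ?_
    exact Metric.isOpen_ball.preimage (T ^ j).continuous
  have hGd : ∀ q, Dense (G q) := by
    rintro ⟨⟨u, hut⟩, i, N⟩
    have hu := htX hut
    rw [Metric.dense_iff]
    intro y₀ r hr
    obtain ⟨y, hyX, hy⟩ := Metric.dense_iff.1 hdense y₀ (r / 2) (by positivity)
    obtain ⟨z, m, hNm, hDm, hz, hzr⟩ := h (u - y) (X₀.sub_mem hu hy) (P y) (hP y hy).1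
      (min (r / 2) (1 / ((i : ℝ) + 1))) (by positivity) (N + 1)
    refine ⟨y + z, ?_, ?_⟩
    · rw [Metric.mem_ball] at hyX ⊢
      calc dist (y + z) y₀ ≤ dist (y + z) y + dist y y₀ := dist_triangle _ _ _
        _ = ‖z‖ + dist y y₀ := by rw [dist_eq_norm]; simp
        _ < r := by linarith [min_le_left (r / 2) (1 / ((i : ℝ) + 1))]
    · -- the visits take place at the times `m + s * P u`, `s ≤ R`
      set R := ⌊α * m / P u⌋₊ with hR
      have hPu : (0 : ℝ) < P u := by exact_mod_cast (hP u hu).1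
      have hm1 : (1 : ℝ) ≤ m := by exact_mod_cast (by omega : 1 ≤ m)
      have hRle : (R : ℝ) * P u ≤ α * m := by
        rw [← le_div_iff₀ hPu]; exact Nat.floor_le (by positivity)
      have hRlt : α * m < (R + 1) * P u := by
        rw [← div_lt_iff₀ hPu]; exact Nat.lt_floor_add_one _
      refine Set.mem_iUnion₂.2 ⟨m + R * P u, by simp only [ge_iff_le]; omega, Set.mem_iUnion₂.2
        ⟨(Finset.range (R + 1)).image fun s => m + s * P u, ⟨?_, ?_⟩, ?_⟩⟩
      · intro j hj
        obtain ⟨s, hs, rfl⟩ := Finset.mem_image.1 hj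
        rw [Finset.mem_range] at hs ⊢
        have : s * P u ≤ R * P u := Nat.mul_le_mul_right _ (by omega)
        omega
      · rw [Finset.card_image_of_injective, Finset.card_range]
        · simp only [hc]
          push_cast
          have h1 : (m : ℝ) + R * P u + 1 ≤ (2 + α) * m := by linarith
          calc α / (P u * (2 + α)) * ((m : ℝ) + R * P u + 1)
              ≤ α / (P u * (2 + α)) * ((2 + α) * m) := by gcongr
            _ = α * m / P u := by field_simp
            _ ≤ R + 1 := by rw [div_le_iff₀ hPu]; exact hRlt.le
        · intro s s' hss
          have := (hP u hu).1
          have h2 : s * P u = s' * P u := by simpa using hss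
          exact Nat.eq_of_mul_eq_mul_right this h2
      · refine Set.mem_iInter₂.2 fun j hj => ?_
        obtain ⟨s, hs, rfl⟩ := Finset.mem_image.1 hj
        rw [Finset.mem_range] at hs
        have hsr : ((s * P u : ℕ) : ℝ) ≤ α * m := by
          push_cast
          have : (s : ℝ) ≤ R := by exact_mod_cast (by omega : s ≤ R)
          nlinarith
        have key := hzr _ hsr
        -- `T ^ m` fixes `y`, and `T ^ (s * P u)` fixes `u`
        have e1 : (T ^ (m + s * P u)) (y + z) - u
            = (T ^ (m + s * P u)) z - (T ^ (s * P u)) (u - y) := by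
          rw [map_add, map_sub, hmul u hu (s * P u) (dvd_mul_left _ _), add_comm m, pow_add,
            mul_apply_eq_comp, mul_apply_eq_comp, hmul y hy m hDm]
          abel
        rw [Set.mem_preimage, Metric.mem_ball, dist_eq_norm, e1]
        exact key.trans_le (min_le_right _ _)
  obtain ⟨x, hx⟩ := (dense_iInter_of_isOpen hGo hGd).nonempty
  refine ⟨x, fun V hV hVne => ?_⟩
  obtain ⟨u, huV, hut⟩ := htd.inter_open_nonempty V hV hVne
  have hu := htX hut
  obtain ⟨ρ, hρ, hball⟩ := Metric.isOpen_iff.1 hV u huV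
  obtain ⟨i, hi⟩ := exists_nat_one_div_lt hρ
  have hcpos : 0 < c u := by
    have hPu : (0 : ℝ) < P u := by exact_mod_cast (hP u hu).1
    simp only [hc]; positivity
  refine hcpos.trans_le (le_upperDensity (frequently_atTop.2 fun N => ?_))
  have := Set.mem_iInter.1 hx (⟨u, hut⟩, i, N)
  obtain ⟨n, hn, hx⟩ := Set.mem_iUnion₂.1 this
  obtain ⟨F, ⟨hF1, hF2⟩, hxF⟩ := Set.mem_iUnion₂.1 hx
  refine ⟨n, hn, hF2.trans ?_⟩
  have hsub : (F : Set ℕ) ⊆ visitTimes (⇑T) x V ∩ Set.Iic n := by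
    intro j hj
    refine ⟨?_, ?_⟩
    · have h3 := Set.mem_iInter₂.1 hxF j hj
      rw [visitTimes, Set.mem_ofPred_eq, iterate_eq_pow]
      exact hball (Metric.ball_subset_ball hi.le h3)
    · have := Finset.mem_range.1 (hF1 hj)
      simp only [Set.mem_Iic]; omega
  have := Set.ncard_le_ncard hsub ((Set.finite_Iic n).inter_of_right _)
  rw [Set.ncard_coe_finset] at this
  exact_mod_cast this

/-! ### Invariance under conjugation -/

variable {Y : Type*} [NormedAddCommGroup Y] [NormedSpace ℂ Y]

theorem conj_pow_apply (e : X ≃L[ℂ] Y) (T : X →L[ℂ] X) (n : ℕ) (x : X) :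
    (⇑((e : X →L[ℂ] Y) ∘L T ∘L (e.symm : Y →L[ℂ] X)))^[n] (e x) = e ((⇑T)^[n] x) := by
  induction n with
  | zero => rfl
  | succ n ih => rw [Function.iterate_succ_apply', ih, Function.iterate_succ_apply']; simp

theorem visitTimes_conj (e : X ≃L[ℂ] Y) (T : X →L[ℂ] X) (x : X) (V : Set Y) :
    visitTimes (⇑((e : X →L[ℂ] Y) ∘L T ∘L (e.symm : Y →L[ℂ] X))) (e x) V =
      visitTimes (⇑T) x (e ⁻¹' V) := by
  ext i
  simp only [visitTimes, Set.mem_ofPred_eq, conj_pow_apply, Set.mem_preimage]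

theorem IsUFrequentlyHypercyclic.conj (e : X ≃L[ℂ] Y) {T : X →L[ℂ] X}
    (h : IsUFrequentlyHypercyclic T) :
    IsUFrequentlyHypercyclic ((e : X →L[ℂ] Y) ∘L T ∘L (e.symm : Y →L[ℂ] X)) := by
  obtain ⟨x, hx⟩ := h
  refine ⟨e x, fun V hV hne => ?_⟩
  rw [visitTimes_conj]
  exact hx _ (hV.preimage e.continuous) (hne.preimage e.surjective)

theorem IsFrequentlyHypercyclic.of_conj (e : X ≃L[ℂ] Y) {T : X →L[ℂ] X}
    (h : IsFrequentlyHypercyclic ((e : X →L[ℂ] Y) ∘L T ∘L (e.symm : Y →L[ℂ] X))) :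
    IsFrequentlyHypercyclic T := by
  obtain ⟨y, hy⟩ := h
  refine ⟨e.symm y, fun V hV hne => ?_⟩
  have := hy (e.symm ⁻¹' V) (hV.preimage e.symm.continuous) (hne.preimage e.symm.surjective)
  rw [← e.apply_symm_apply y, visitTimes_conj] at this
  simpa [← Set.preimage_comp, Function.comp_def] using this

theorem IsChaotic.conj (e : X ≃L[ℂ] Y) {T : X →L[ℂ] X} (h : IsChaotic T) :
    IsChaotic ((e : X →L[ℂ] Y) ∘L T ∘L (e.symm : Y →L[ℂ] X)) := by
  obtain ⟨⟨x, hx⟩, hp⟩ := h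
  refine ⟨⟨e x, ?_⟩, ?_⟩
  · have := e.surjective.denseRange.dense_image e.continuous hx
    refine this.mono ?_
    rintro _ ⟨_, ⟨n, rfl⟩, rfl⟩
    exact ⟨n, conj_pow_apply e T n x⟩
  · have := e.surjective.denseRange.dense_image e.continuous hp
    refine this.mono ?_
    rintro _ ⟨z, ⟨n, hn, hz⟩, rfl⟩
    exact ⟨n, hn, (conj_pow_apply e T n z).trans (congrArg e hz)⟩

end Dynamics

/-! ### The sequence spaces `ℓ_p(ℕ)` -/

section EllP

variable {p : ℝ≥0∞}

theorem single_one_apply (k m : ℕ) :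
    (lp.single p k 1 : lp (fun _ : ℕ => ℂ) p) m = if m = k then 1 else 0 := by
  rw [lp.single_apply, Pi.single_apply]

variable [Fact (1 ≤ p)]

theorem hasSum_smul_single (hp : p ≠ ∞) (x : lp (fun _ : ℕ => ℂ) p) :
    HasSum (fun k : ℕ => x k • (lp.single p k 1 : lp (fun _ : ℕ => ℂ) p)) x := by
  convert lp.hasSum_single hp x using 2 with k
  rw [← lp.single_smul, smul_eq_mul, mul_one]

theorem dense_span_single (hp : p ≠ ∞) :
    Dense (Submodule.span ℂ (Set.range fun k : ℕ =>
      (lp.single p k 1 : lp (fun _ : ℕ => ℂ) p)) : Set (lp (fun _ : ℕ => ℂ) p)) := by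
  intro x
  refine mem_closure_of_tendsto (hasSum_smul_single hp x) (Eventually.of_forall fun s => ?_)
  exact Submodule.sum_mem _ fun k _ =>
    Submodule.smul_mem _ _ (Submodule.subset_span ⟨k, rfl⟩)

theorem separableSpace_lp (hp : p ≠ ∞) :
    TopologicalSpace.SeparableSpace (lp (fun _ : ℕ => ℂ) p) := by
  have h1 : TopologicalSpace.IsSeparable (Submodule.span ℂ (Set.range fun k : ℕ =>
      (lp.single p k 1 : lp (fun _ : ℕ => ℂ) p)) : Set (lp (fun _ : ℕ => ℂ) p)) :=
    (Set.countable_range _).isSeparable.span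
  have h2 := h1.closure
  rw [(dense_span_single hp).closure_eq] at h2
  exact TopologicalSpace.isSeparable_univ_iff.1 h2

theorem ext_single (hp : p ≠ ∞) {S T : lp (fun _ : ℕ => ℂ) p →L[ℂ] lp (fun _ : ℕ => ℂ) p}
    (h : ∀ k : ℕ, S (lp.single p k 1) = T (lp.single p k 1)) : S = T := by
  ext1 x
  have h1 := (hasSum_smul_single hp x).mapL S
  have h2 := (hasSum_smul_single hp x).mapL T
  simp only [map_smul, h] at h1 h2
  exact h1.unique h2

theorem norm_single_one (k : ℕ) : ‖(lp.single p k 1 : lp (fun _ : ℕ => ℂ) p)‖ = 1 := by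
  rw [lp.norm_single (zero_lt_one.trans_le Fact.out), norm_one]

theorem toReal_pos_of_fact (hp : p ≠ ∞) : 0 < p.toReal :=
  ENNReal.toReal_pos (zero_lt_one.trans_le Fact.out).ne' hp

theorem one_le_toReal_of_fact (hp : p ≠ ∞) : 1 ≤ p.toReal := by
  rw [← ENNReal.toReal_one, ENNReal.toReal_le_toReal (by simp) hp]
  exact Fact.out

/-- A bounded diagonal operator composed with an injective change of index is a bounded operator. -/
theorem exists_weighted_comp (hp : p ≠ ∞) (c : ℕ → ℂ) (ψ : ℕ → ℕ) (hψ : ψ.Injective) (M : ℝ)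
    (hc : ∀ m, ‖c m‖ ≤ M) :
    ∃ S : lp (fun _ : ℕ => ℂ) p →L[ℂ] lp (fun _ : ℕ => ℂ) p, ∀ x m, S x m = c m * x (ψ m) := by
  have hp0 := toReal_pos_of_fact (p := p) hp
  have hM : 0 ≤ M := (norm_nonneg _).trans (hc 0)
  have key : ∀ (x : lp (fun _ : ℕ => ℂ) p) (s : Finset ℕ),
      ∑ m ∈ s, ‖c m * x (ψ m)‖ ^ p.toReal ≤ (M * ‖x‖) ^ p.toReal := by
    intro x s
    calc ∑ m ∈ s, ‖c m * x (ψ m)‖ ^ p.toReal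
        ≤ ∑ m ∈ s, M ^ p.toReal * ‖x (ψ m)‖ ^ p.toReal := by
          refine Finset.sum_le_sum fun m _ => ?_
          rw [← Real.mul_rpow hM (norm_nonneg _), norm_mul]
          gcongr
          exact hc m
      _ = M ^ p.toReal * ∑ k ∈ s.image ψ, ‖x k‖ ^ p.toReal := by
          rw [Finset.sum_image hψ.injOn, Finset.mul_sum]
      _ ≤ M ^ p.toReal * ‖x‖ ^ p.toReal := by
          gcongr
          exact lp.sum_rpow_le_norm_rpow hp0 x _
      _ = (M * ‖x‖) ^ p.toReal := (Real.mul_rpow hM (norm_nonneg _)).symm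
  let S : lp (fun _ : ℕ => ℂ) p →ₗ[ℂ] lp (fun _ : ℕ => ℂ) p :=
    { toFun := fun x => ⟨fun m => c m * x (ψ m), memℓp_gen' (key x)⟩
      map_add' := fun x y => by
        ext m
        exact mul_add _ _ _
      map_smul' := fun a x => by
        ext m
        exact mul_left_comm _ _ _ }
  refine ⟨S.mkContinuous M fun x => ?_, fun x m => rfl⟩
  exact lp.norm_le_of_forall_sum_le hp0 (by positivity) (key x)

/-- Hölder's inequality on finitely many coordinates. -/
theorem sum_norm_apply_le (hp : p ≠ ∞) (y : lp (fun _ : ℕ => ℂ) p) (a N : ℕ) :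
    ∑ i ∈ Finset.range N, ‖y (a + i)‖ ≤ (N : ℝ) ^ (1 - 1 / p.toReal) * ‖y‖ := by
  have hp1 := one_le_toReal_of_fact (p := p) hp
  have hp0 := toReal_pos_of_fact (p := p) hp
  rcases Nat.eq_zero_or_pos N with rfl | hN
  · simp only [Finset.range_zero, Finset.sum_empty]
    positivity
  have h1 := Real.rpow_sum_le_const_mul_sum_rpow_of_nonneg (s := Finset.range N)
    (f := fun i => ‖y (a + i)‖) hp1 (fun i _ => norm_nonneg _)
  have h2 : ∑ i ∈ Finset.range N, ‖y (a + i)‖ ^ p.toReal ≤ ‖y‖ ^ p.toReal := by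
    have := lp.sum_rpow_le_norm_rpow hp0 y ((Finset.range N).image fun i => a + i)
    rwa [Finset.sum_image (fun i _ j _ h => by simpa using h)] at this
  rw [Finset.card_range] at h1
  have hN0 : (0 : ℝ) < N := by exact_mod_cast hN
  rw [← Real.rpow_le_rpow_iff (Finset.sum_nonneg fun i _ => norm_nonneg _) (by positivity) hp0]
  refine h1.trans ?_
  rw [Real.mul_rpow (by positivity) (norm_nonneg _), ← Real.rpow_mul hN0.le]
  have : (1 - 1 / p.toReal) * p.toReal = p.toReal - 1 := by field_simp
  rw [this]
  gcongr

end EllP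

/-! ### Blocks and the operator of C-type -/

namespace CTypeData

variable (d : CTypeData)

/-- The length of the `n`-th block. -/
def blockLen (n : ℕ) : ℕ := d.b (n + 1) - d.b n

theorem blockLen_pos (n : ℕ) : 0 < d.blockLen n :=
  Nat.sub_pos_of_lt (d.b_strictMono (Nat.lt_succ_self n))

theorem b_succ (n : ℕ) : d.b (n + 1) = d.b n + d.blockLen n := by
  have := d.b_strictMono (Nat.lt_succ_self n)
  simp only [blockLen, Nat.succ_eq_add_one] at *
  omega

/-- Every index is the index number `i` of the block number `n` for some `n`, `i`. -/
theorem exists_block (m : ℕ) : ∃ n i, i < d.blockLen n ∧ m = d.b n + i := by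
  induction m with
  | zero => exact ⟨0, 0, d.blockLen_pos 0, by rw [d.b_zero]⟩
  | succ m ih =>
    obtain ⟨n, i, hi, rfl⟩ := ih
    rcases Nat.lt_or_ge (i + 1) (d.blockLen n) with h | h
    · exact ⟨n, i + 1, h, rfl⟩
    · exact ⟨n + 1, 0, d.blockLen_pos _, by rw [d.b_succ]; omega⟩

theorem block_lt_of_lt {n n' i i' : ℕ} (hi : i < d.blockLen n) (h : n < n') :
    d.b n + i < d.b n' + i' := by
  have := d.b_strictMono.monotone (Nat.succ_le_of_lt h)
  rw [Nat.succ_eq_add_one, d.b_succ] at this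
  omega

theorem block_unique {n n' i i' : ℕ} (hi : i < d.blockLen n) (hi' : i' < d.blockLen n')
    (h : d.b n + i = d.b n' + i') : n = n' ∧ i = i' := by
  have hn : n = n' := by
    rcases Nat.lt_trichotomy n n' with hlt | heq | hlt
    · exact absurd h (d.block_lt_of_lt hi hlt).ne
    · exact heq
    · exact absurd h (d.block_lt_of_lt hi' hlt).ne'
  subst hn
  exact ⟨rfl, by omega⟩

/-- The decomposition of `ℕ` into the blocks `[b n, b (n + 1))`. -/
noncomputable def blockEquiv : (Σ n, Fin (d.blockLen n)) ≃ ℕ :=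
  Equiv.ofBijective (fun q => d.b q.1 + q.2) <| by
    constructor
    · rintro ⟨n, i, hi⟩ ⟨n', i', hi'⟩ h
      obtain ⟨rfl, rfl⟩ := d.block_unique hi hi' h
      rfl
    · intro m
      obtain ⟨n, i, hi, rfl⟩ := d.exists_block m
      exact ⟨⟨n, i, hi⟩, rfl⟩

theorem hasSum_blocks {p : ℝ≥0∞} [Fact (1 ≤ p)] (hp : p ≠ ∞) (x : lp (fun _ : ℕ => ℂ) p) :
    HasSum (fun n => ∑ i ∈ Finset.range (d.blockLen n), x (d.b n + i) •
      (lp.single p (d.b n + i) 1 : lp (fun _ : ℕ => ℂ) p)) x := by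
  have h := (d.blockEquiv.hasSum_iff).2 (hasSum_smul_single hp x)
  refine (h.sigma fun n => hasSum_fintype _).congr_fun ?_
  intro n
  rw [← Fin.sum_univ_eq_sum_range (fun i => x (d.b n + i) •
      (lp.single p (d.b n + i) 1 : lp (fun _ : ℕ => ℂ) p))]
  rfl

theorem norm_blockProd (n : ℕ) :
    ‖d.blockProd n‖ = ∏ j ∈ Finset.Ioo (d.b n) (d.b (n + 1)), ‖d.w j‖ := by
  rw [blockProd, norm_prod]

theorem w_ne_zero {j : ℕ} (hj : 1 ≤ j) : d.w j ≠ 0 := by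
  obtain ⟨m, hm, h⟩ := d.w_bounded_below
  exact norm_pos_iff.1 (hm.trans_le (h j hj))

theorem blockProd_ne_zero (n : ℕ) : d.blockProd n ≠ 0 := by
  refine Finset.prod_ne_zero_iff.2 fun j hj => d.w_ne_zero ?_
  have := (Finset.mem_Ioo.1 hj).1
  omega

/-- The predecessor map of the cyclic shifts on the blocks: the predecessor of the first index
`b n` of a block is its last index, and that of any other `m` is `m - 1`. -/
noncomputable def pred (m : ℕ) : ℕ :=
  open Classical in if h : ∃ n, m = d.b n then d.b (h.choose + 1) - 1 else m - 1

theorem pred_b (n : ℕ) : d.pred (d.b n) = d.b n + (d.blockLen n - 1) := by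
  have h : ∃ n', d.b n = d.b n' := ⟨n, rfl⟩
  have h2 : h.choose = n := (d.b_strictMono.injective h.choose_spec).symm
  have h3 := d.blockLen_pos n
  rw [pred, dif_pos h, h2, b_succ]
  omega

theorem not_exists_b {n i : ℕ} (hi : i + 1 < d.blockLen n) : ¬ ∃ n', d.b n + (i + 1) = d.b n' := by
  rintro ⟨n', h⟩
  have := d.block_unique (i' := 0) hi (d.blockLen_pos n') h
  omega

theorem pred_succ {n i : ℕ} (hi : i + 1 < d.blockLen n) :
    d.pred (d.b n + (i + 1)) = d.b n + i := by
  rw [pred, dif_neg (d.not_exists_b hi)]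
  omega

theorem pred_injective : d.pred.Injective := by
  intro m m' h
  obtain ⟨n, i, hi, rfl⟩ := d.exists_block m
  obtain ⟨n', i', hi', rfl⟩ := d.exists_block m'
  have hL := d.blockLen_pos n
  have hL' := d.blockLen_pos n'
  rcases i with _ | i <;> rcases i' with _ | i'
  · rw [add_zero, add_zero, pred_b, pred_b] at h
    rw [(d.block_unique (by omega) (by omega) h).1]
  · rw [add_zero, pred_b, d.pred_succ hi'] at h
    obtain ⟨rfl, h⟩ := d.block_unique (by omega) (by omega) h
    omega
  · rw [add_zero, pred_b, d.pred_succ hi] at h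
    obtain ⟨rfl, h⟩ := d.block_unique (by omega) (by omega) h
    omega
  · rw [d.pred_succ hi, d.pred_succ hi'] at h
    obtain ⟨rfl, rfl⟩ := d.block_unique (by omega) (by omega) h
    rfl

/-- The coefficients of the cyclic weighted shifts on the blocks: the operator of C-type, without
its terms `v n`, maps `e_{pred m}` to `cyc m • e_m`. -/
noncomputable def cyc (m : ℕ) : ℂ :=
  open Classical in if h : ∃ n, m = d.b n then -(d.blockProd h.choose)⁻¹ else d.w m

theorem cyc_b (n : ℕ) : d.cyc (d.b n) = -(d.blockProd n)⁻¹ := by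
  have h : ∃ n', d.b n = d.b n' := ⟨n, rfl⟩
  have h2 : h.choose = n := (d.b_strictMono.injective h.choose_spec).symm
  rw [cyc, dif_pos h, h2]

theorem cyc_succ {n i : ℕ} (hi : i + 1 < d.blockLen n) :
    d.cyc (d.b n + (i + 1)) = d.w (d.b n + (i + 1)) := by
  rw [cyc, dif_neg (d.not_exists_b hi)]

theorem exists_norm_cyc_le : ∃ M : ℝ, ∀ m, ‖d.cyc m‖ ≤ M := by
  obtain ⟨M, hM⟩ := d.w_bounded
  obtain ⟨c, hc, h⟩ := d.prod_bounded_below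
  refine ⟨max M c⁻¹, fun m => ?_⟩
  obtain ⟨n, i, hi, rfl⟩ := d.exists_block m
  rcases i with _ | i
  · rw [add_zero, cyc_b, norm_neg, norm_inv, norm_blockProd]
    exact (inv_anti₀ hc (h n)).trans (le_max_right _ _)
  · rw [d.cyc_succ hi]
    exact (hM _ (by omega)).trans (le_max_left _ _)

/-- Existence of the operator of C-type: the sum of the cyclic weighted shifts on the blocks and
of a nuclear perturbation. -/
theorem exists_isOperator {p : ℝ≥0∞} [Fact (1 ≤ p)] (hp : p ≠ ∞) :
    ∃ T : lp (fun _ : ℕ => ℂ) p →L[ℂ] lp (fun _ : ℕ => ℂ) p, d.IsOperator p T := by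
  obtain ⟨M, hM⟩ := d.exists_norm_cyc_le
  obtain ⟨S, hS⟩ := exists_weighted_comp (p := p) hp d.cyc d.pred d.pred_injective M hM
  have hSe : ∀ m, S (lp.single p (d.pred m) 1) = d.cyc m • lp.single p m 1 := by
    intro m
    ext m'
    rw [hS, lp.coeFn_smul, Pi.smul_apply, single_one_apply, single_one_apply]
    rcases eq_or_ne m' m with rfl | h
    · simp
    · rw [if_neg h, if_neg (fun h' => h (d.pred_injective h'))]; simp
  let F : ℕ → lp (fun _ : ℕ => ℂ) p →L[ℂ] lp (fun _ : ℕ => ℂ) p := fun n =>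
    d.v (n + 1) • (lp.evalCLM ℂ (fun _ : ℕ => ℂ) p (d.b (n + 1 + 1) - 1)).smulRight
      (lp.single p (d.b (d.φ (n + 1))) 1)
  have hF : Summable F := by
    refine Summable.of_norm_bounded d.v_summable fun n => ?_
    rw [norm_smul]
    refine mul_le_of_le_one_right (norm_nonneg _) ?_
    rw [ContinuousLinearMap.norm_smulRight_apply, norm_single_one, mul_one]
    refine ContinuousLinearMap.opNorm_le_bound _ zero_le_one fun x => ?_
    rw [one_mul]
    exact lp.norm_apply_le_norm (zero_lt_one.trans_le Fact.out).ne' x _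
  have hFe : ∀ k, (∑' n, F n) (lp.single p k 1) = ∑' n, F n (lp.single p k 1) := by
    intro k
    exact (hF.hasSum.mapL (ContinuousLinearMap.apply ℂ _ (lp.single p k 1))).tsum_eq.symm
  have hFn : ∀ n k, F n (lp.single p k 1) =
      if d.b (n + 1 + 1) - 1 = k then d.v (n + 1) • lp.single p (d.b (d.φ (n + 1))) 1 else 0 := by
    intro n k
    have : F n (lp.single p k 1) = d.v (n + 1) •
        (lp.single p k 1 : lp (fun _ : ℕ => ℂ) p) (d.b (n + 1 + 1) - 1) •
          lp.single p (d.b (d.φ (n + 1))) 1 := rfl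
    rw [this, single_one_apply]
    split_ifs <;> simp
  have hlast : ∀ n, d.b (n + 1) - 1 = d.b n + (d.blockLen n - 1) := by
    intro n
    have := d.blockLen_pos n
    rw [b_succ]; omega
  have hlastlt : ∀ n, d.blockLen n - 1 < d.blockLen n := fun n => by
    have := d.blockLen_pos n; omega
  have hzero : ∀ k, (∀ n, d.b (n + 1 + 1) - 1 ≠ k) → (∑' n, F n) (lp.single p k 1) = 0 := by
    intro k hk
    rw [hFe]
    refine (tsum_congr fun n => ?_).trans tsum_zero
    rw [hFn, if_neg (hk n)]
  refine ⟨S + ∑' n, F n, ⟨?_, ?_, ?_⟩⟩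
  · intro n k h1 h2
    obtain ⟨i, rfl⟩ := Nat.exists_eq_add_of_le h1
    rw [b_succ] at h2
    have hi : i + 1 < d.blockLen n := by omega
    rw [add_apply, hzero, add_zero, ← d.pred_succ hi, hSe, d.cyc_succ hi, d.pred_succ hi]
    · rfl
    · intro n' h
      rw [hlast] at h
      obtain ⟨rfl, h⟩ := d.block_unique (hlastlt _) (by omega) h
      omega
  · intro n hn
    obtain ⟨n, rfl⟩ := Nat.exists_eq_add_of_le' hn
    rw [add_apply, hFe, tsum_eq_single n, hFn, if_pos rfl, hlast, ← pred_b, hSe, cyc_b, neg_smul,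
      sub_eq_add_neg, add_comm]
    intro n' hne
    rw [hFn, if_neg]
    intro h
    rw [hlast, hlast] at h
    have := (d.block_unique (hlastlt _) (hlastlt _) h).1
    omega
  · have h0 := hlast 0
    rw [zero_add] at h0
    rw [add_apply, hzero, add_zero, h0, ← pred_b, hSe, cyc_b, d.b_zero, neg_smul]
    intro n' h
    rw [h0, hlast] at h
    have := (d.block_unique (hlastlt _) (hlastlt _) h).1
    omega

theorem existsUnique_isOperator {p : ℝ≥0∞} [Fact (1 ≤ p)] (hp : p ≠ ∞) :
    ∃! T : lp (fun _ : ℕ => ℂ) p →L[ℂ] lp (fun _ : ℕ => ℂ) p, d.IsOperator p T := by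
  obtain ⟨T, hT⟩ := d.exists_isOperator hp
  refine ⟨T, hT, fun S hS => ext_single hp fun k => ?_⟩
  obtain ⟨n, i, hi, rfl⟩ := d.exists_block k
  have hb := d.b_succ n
  rcases Nat.lt_or_ge (i + 1) (d.blockLen n) with h | h
  · rw [hS.apply_inner n _ (by omega) (by omega), hT.apply_inner n _ (by omega) (by omega)]
  · have : d.b n + i = d.b (n + 1) - 1 := by omega
    rw [this]
    rcases Nat.eq_zero_or_pos n with rfl | hn
    · rw [zero_add, hS.apply_last_zero, hT.apply_last_zero]
    · rw [hS.apply_last n hn, hT.apply_last n hn]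

end CTypeData

/-! ### The dynamics on the canonical basis -/

namespace CTypeData

variable (d : CTypeData)

/-- The product `w_{b_n + 1} ⋯ w_{b_n + i}` of the first `i` weights of the `n`-th block. -/
noncomputable def partialProd (n i : ℕ) : ℂ := ∏ j ∈ Finset.range i, d.w (d.b n + (j + 1))

theorem partialProd_ne_zero (n i : ℕ) : d.partialProd n i ≠ 0 :=
  Finset.prod_ne_zero_iff.2 fun _ _ => d.w_ne_zero (by omega)

theorem blockProd_eq (n : ℕ) : d.blockProd n = d.partialProd n (d.blockLen n - 1) := by
  have h : Finset.Ioo (d.b n) (d.b (n + 1)) = Finset.Ico (d.b n + 1) (d.b (n + 1)) := by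
    ext j; simp only [Finset.mem_Ioo, Finset.mem_Ico]; omega
  rw [blockProd, partialProd, h, Finset.prod_Ico_eq_prod_range]
  have h2 : d.b (n + 1) - (d.b n + 1) = d.blockLen n - 1 := by rw [b_succ]; omega
  rw [h2]
  exact Finset.prod_congr rfl fun j _ => by congr 1; omega

/-- The coefficient with which one turn in the `n`-th block feeds the block number `φ n`. The
block number `0` feeds no other block, and the value at `0` records this. -/
noncomputable def coupling (n : ℕ) : ℂ := if n = 0 then 0 else d.blockProd n * d.v n

theorem two_mul_blockLen_dvd {n : ℕ} (hn : 1 ≤ n) : 2 * d.blockLen (d.φ n) ∣ d.blockLen n :=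
  d.b_dvd n hn

/-- The part of `x` carried by the `n`-th block. -/
noncomputable def blockPart {p : ℝ≥0∞} (n : ℕ)
    (x : lp (fun _ : ℕ => ℂ) p) : lp (fun _ : ℕ => ℂ) p :=
  ∑ i ∈ Finset.range (d.blockLen n), x (d.b n + i) • lp.single p (d.b n + i) 1

/-- The size `|x_{b_n + i}| / |w_{b_n + 1} ⋯ w_{b_n + i}|` of the coordinate number `i` of `x` in
the `n`-th block, referred to the beginning of the block. -/
noncomputable def mass {p : ℝ≥0∞} (n : ℕ) (x : lp (fun _ : ℕ => ℂ) p)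
    (i : ℕ) : ℝ := ‖x (d.b n + i)‖ / ‖d.partialProd n i‖

/-- The total mass of the coordinates in the `n`-th block that reach the end of the block by the
time `J`. -/
noncomputable def leakedMass {p : ℝ≥0∞} (n : ℕ)
    (x : lp (fun _ : ℕ => ℂ) p) (J : ℕ) : ℝ :=
  ∑ i ∈ (Finset.range (d.blockLen n)).filter (fun i => d.blockLen n ≤ i + J), d.mass n x i

theorem mass_nonneg {p : ℝ≥0∞} (n : ℕ) (x : lp (fun _ : ℕ => ℂ) p) (i : ℕ) :
    0 ≤ d.mass n x i := div_nonneg (norm_nonneg _) (norm_nonneg _)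

namespace IsOperator

variable {d} {p : ℝ≥0∞} [Fact (1 ≤ p)] {T : lp (fun _ : ℕ => ℂ) p →L[ℂ] lp (fun _ : ℕ => ℂ) p}

theorem pow_apply_start (hT : d.IsOperator p T) (n : ℕ) {i : ℕ} (hi : i < d.blockLen n) :
    (T ^ i) (lp.single p (d.b n) 1) = d.partialProd n i • lp.single p (d.b n + i) 1 := by
  induction i with
  | zero => simp [partialProd]
  | succ i ih =>
    rw [pow_succ', mul_apply_eq_comp, ih (by omega), map_smul,
      hT.apply_inner n _ (by omega) (by rw [b_succ]; omega), smul_smul, partialProd, partialProd,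
      Finset.prod_range_succ]
    rfl

/-- One turn of the first vector of a block: it comes back with the opposite sign, and feeds the
first vector of the block number `φ n`. -/
theorem pow_len_apply_start (hT : d.IsOperator p T) (n : ℕ) :
    (T ^ d.blockLen n) (lp.single p (d.b n) 1) =
      d.coupling n • lp.single p (d.b (d.φ n)) 1 - lp.single p (d.b n) 1 := by
  have hL := d.blockLen_pos n
  have hP := d.blockProd_ne_zero n
  have e1 : d.blockLen n = (d.blockLen n - 1) + 1 := by omega
  have e2 : d.b n + (d.blockLen n - 1) = d.b (n + 1) - 1 := by rw [b_succ]; omega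
  rw [e1, pow_succ', mul_apply_eq_comp, hT.pow_apply_start n (by omega), map_smul, ← blockProd_eq,
    e2]
  rcases Nat.eq_zero_or_pos n with rfl | hn
  · rw [zero_add, hT.apply_last_zero, smul_neg, smul_smul, mul_inv_cancel₀ hP, coupling, if_pos rfl,
      d.b_zero, one_smul, zero_smul, zero_sub]
  · rw [hT.apply_last n hn, smul_sub, smul_smul, smul_smul, mul_inv_cancel₀ hP, coupling,
      if_neg (by omega), one_smul]

/-- The first vector of a block is fixed by two turns: the block number `φ n` is fed twice with
opposite signs, and the length of the `n`-th block is a period of its first vector. -/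
theorem pow_two_mul_len_apply_start (hT : d.IsOperator p T) (n : ℕ) :
    (T ^ (2 * d.blockLen n)) (lp.single p (d.b n) 1) = lp.single p (d.b n) 1 := by
  induction n using Nat.strong_induction_on with
  | _ n ih =>
    rw [two_mul, pow_add, mul_apply_eq_comp, hT.pow_len_apply_start, map_sub, map_smul,
      hT.pow_len_apply_start]
    rcases Nat.eq_zero_or_pos n with rfl | hn
    · simp [coupling]
    · rw [pow_apply_of_dvd (ih _ (d.φ_lt n hn)) (d.two_mul_blockLen_dvd hn)]
      abel

theorem pow_len_add_apply_start (hT : d.IsOperator p T) (n q : ℕ) :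
    (T ^ (d.blockLen n + q)) (lp.single p (d.b n) 1) =
      d.coupling n • (T ^ q) (lp.single p (d.b (d.φ n)) 1) -
        (T ^ q) (lp.single p (d.b n) 1) := by
  rw [add_comm, pow_add, mul_apply_eq_comp, hT.pow_len_apply_start, map_sub, map_smul]

theorem single_eq (hT : d.IsOperator p T) (n : ℕ) {i : ℕ} (hi : i < d.blockLen n) :
    (lp.single p (d.b n + i) 1 : lp (fun _ : ℕ => ℂ) p) =
      (d.partialProd n i)⁻¹ • (T ^ i) (lp.single p (d.b n) 1) := by
  rw [hT.pow_apply_start n hi, smul_smul, inv_mul_cancel₀ (d.partialProd_ne_zero n i), one_smul]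

/-- Every finitely supported vector is periodic. -/
theorem mem_periodicPts_of_mem_span (hT : d.IsOperator p T) {x : lp (fun _ : ℕ => ℂ) p}
    (hx : x ∈ Submodule.span ℂ (Set.range fun k : ℕ =>
      (lp.single p k 1 : lp (fun _ : ℕ => ℂ) p))) : x ∈ Function.periodicPts ⇑T := by
  suffices h : ∃ D, 0 < D ∧ (T ^ D) x = x by
    obtain ⟨D, hD, h⟩ := h
    exact ⟨D, hD, (iterate_eq_pow T D x).trans h⟩
  induction hx using Submodule.span_induction with
  | mem x hx =>
    obtain ⟨k, rfl⟩ := hx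
    obtain ⟨n, i, hi, rfl⟩ := d.exists_block k
    refine ⟨2 * d.blockLen n, by have := d.blockLen_pos n; omega, ?_⟩
    simp only
    rw [hT.single_eq n hi, map_smul, ← mul_apply_eq_comp, ← pow_add, add_comm, pow_add,
      mul_apply_eq_comp, hT.pow_two_mul_len_apply_start]
  | zero => exact ⟨1, one_pos, map_zero _⟩
  | add x y _ _ hx hy =>
    obtain ⟨D, hD, hx⟩ := hx
    obtain ⟨E, hE, hy⟩ := hy
    refine ⟨D * E, Nat.mul_pos hD hE, ?_⟩
    rw [map_add, pow_apply_of_dvd hx (dvd_mul_right _ _), pow_apply_of_dvd hy (dvd_mul_left _ _)]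
  | smul a x _ hx =>
    obtain ⟨D, hD, hx⟩ := hx
    exact ⟨D, hD, by rw [map_smul, hx]⟩

/-- The orbit of the first vector of a block never reaches the following blocks. -/
theorem pow_apply_start_eq_zero (hT : d.IsOperator p T) (n j : ℕ) {k : ℕ}
    (hk : d.b (n + 1) ≤ k) : (T ^ j) (lp.single p (d.b n) 1) k = 0 := by
  induction n using Nat.strong_induction_on generalizing j with
  | _ n ih =>
    have hin : ∀ q, q < d.blockLen n → (T ^ q) (lp.single p (d.b n) 1) k = 0 := by
      intro q hq
      rw [hT.pow_apply_start n hq, lp.coeFn_smul, Pi.smul_apply, single_one_apply, if_neg,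
        smul_zero]
      rw [b_succ] at hk
      omega
    rw [← pow_mod_apply (hT.pow_two_mul_len_apply_start n) j]
    have hq : j % (2 * d.blockLen n) < 2 * d.blockLen n :=
      Nat.mod_lt _ (by have := d.blockLen_pos n; omega)
    generalize j % (2 * d.blockLen n) = q at hq
    rcases Nat.lt_or_ge q (d.blockLen n) with h | h
    · exact hin q h
    · obtain ⟨r, rfl⟩ := Nat.exists_eq_add_of_le h
      rw [hT.pow_len_add_apply_start, lp.coeFn_sub, Pi.sub_apply, hin r (by omega), lp.coeFn_smul,
        Pi.smul_apply, sub_zero]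
      rcases Nat.eq_zero_or_pos n with rfl | hn
      · simp [coupling]
      · rw [ih _ (d.φ_lt n hn) r ((d.b_strictMono.monotone (by have := d.φ_lt n hn; omega)).trans hk),
          smul_zero]

/-- The orbit of `e_{b_n}` turns in the `n`-th block, up to a contribution `o` of the lower blocks,
which vanishes during the first turn. -/
theorem exists_pow_apply_start (hT : d.IsOperator p T) (n m : ℕ) {M : ℝ}
    (hM : ∀ j, ‖(T ^ j) (lp.single p (d.b (d.φ n)) 1)‖ ≤ M) :
    ∃ (s : ℂ) (o : lp (fun _ : ℕ => ℂ) p), ‖s‖ = 1 ∧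
      (T ^ m) (lp.single p (d.b n) 1) =
        (s * d.partialProd n (m % d.blockLen n)) •
          lp.single p (d.b n + m % d.blockLen n) 1 + o ∧
      (∀ k, d.b n ≤ k → o k = 0) ∧ (m < d.blockLen n → o = 0) ∧ ‖o‖ ≤ ‖d.coupling n‖ * M := by
  have hL := d.blockLen_pos n
  have hM0 : 0 ≤ M := (norm_nonneg _).trans (hM 0)
  have hq : m % (2 * d.blockLen n) < 2 * d.blockLen n := Nat.mod_lt _ (by omega)
  have hqL : m % (2 * d.blockLen n) % d.blockLen n = m % d.blockLen n :=
    Nat.mod_mod_of_dvd _ (dvd_mul_left _ _)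
  rw [← pow_mod_apply (hT.pow_two_mul_len_apply_start n) m]
  rcases Nat.lt_or_ge (m % (2 * d.blockLen n)) (d.blockLen n) with h | h
  · rw [Nat.mod_eq_of_lt h] at hqL
    refine ⟨1, 0, norm_one, ?_, fun _ _ => rfl, fun _ => rfl, ?_⟩
    · rw [hqL, hT.pow_apply_start n (Nat.mod_lt _ hL), one_mul, add_zero]
    · rw [norm_zero]; positivity
  · have hmL : ¬ m < d.blockLen n := fun hlt => by
      rw [Nat.mod_eq_of_lt (by omega)] at h; omega
    obtain ⟨r, hr⟩ := Nat.exists_eq_add_of_le h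
    rw [hr] at hqL hq ⊢
    rw [Nat.add_mod_left, Nat.mod_eq_of_lt (by omega)] at hqL
    refine ⟨-1, d.coupling n • (T ^ r) (lp.single p (d.b (d.φ n)) 1), by simp, ?_, ?_,
      fun hlt => absurd hlt hmL, ?_⟩
    · rw [hT.pow_len_add_apply_start, hqL, hT.pow_apply_start n (Nat.mod_lt _ hL), neg_one_mul,
        neg_smul, sub_eq_add_neg, add_comm]
    · intro k hk
      rw [lp.coeFn_smul, Pi.smul_apply]
      rcases Nat.eq_zero_or_pos n with rfl | hn
      · simp [coupling]
      · rw [hT.pow_apply_start_eq_zero _ _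
          ((d.b_strictMono.monotone (by have := d.φ_lt n hn; omega)).trans hk), smul_zero]
    · rw [norm_smul]
      gcongr
      exact hM r

/-- The orbit of the part of `x` in the `n`-th block, up to time `J`: the part `A` that remains in
the block and the part `O` that goes to lower blocks. -/
theorem exists_pow_apply_blockPart (hT : d.IsOperator p T) (n : ℕ) {M : ℝ}
    (hM : ∀ j, ‖(T ^ j) (lp.single p (d.b (d.φ n)) 1)‖ ≤ M) (x : lp (fun _ : ℕ => ℂ) p)
    {j J : ℕ} (hj : j ≤ J) :
    ∃ A O : lp (fun _ : ℕ => ℂ) p, (T ^ j) (d.blockPart n x) = A + O ∧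
      (∀ k, d.b n ≤ k → O k = 0) ∧ ‖O‖ ≤ ‖d.coupling n‖ * M * d.leakedMass n x J ∧
      (∀ k, (k < d.b n ∨ d.b (n + 1) ≤ k) → A k = 0) ∧
      ∀ i, i < d.blockLen n → ‖A (d.b n + (i + j) % d.blockLen n)‖ =
        d.mass n x i * ‖d.partialProd n ((i + j) % d.blockLen n)‖ := by
  have hL := d.blockLen_pos n
  choose s o hs hTm ho hoL hoM using fun m => hT.exists_pow_apply_start n m hM
  set c : ℕ → ℂ := fun i => x (d.b n + i) * (d.partialProd n i)⁻¹ with hc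
  have hcn : ∀ i, ‖c i‖ = d.mass n x i := fun i => by
    rw [hc, norm_mul, norm_inv, mass, div_eq_mul_inv]
  have hlt : ∀ i, (i + j) % d.blockLen n < d.blockLen n := fun i => Nat.mod_lt _ hL
  refine ⟨∑ i ∈ Finset.range (d.blockLen n),
      (c i * (s (i + j) * d.partialProd n ((i + j) % d.blockLen n))) •
        lp.single p (d.b n + (i + j) % d.blockLen n) 1,
    ∑ i ∈ Finset.range (d.blockLen n), c i • o (i + j), ?_, ?_, ?_, ?_, ?_⟩
  · rw [blockPart, map_sum, ← Finset.sum_add_distrib]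
    refine Finset.sum_congr rfl fun i hi => ?_
    rw [map_smul, hT.single_eq n (Finset.mem_range.1 hi), map_smul, ← mul_apply_eq_comp,
      ← pow_add, add_comm j i, hTm (i + j), smul_smul, smul_add, smul_smul]
  · intro k hk
    rw [lp.coeFn_sum, Finset.sum_apply]
    refine Finset.sum_eq_zero fun i _ => ?_
    rw [lp.coeFn_smul, Pi.smul_apply, ho _ k hk, smul_zero]
  · rw [leakedMass, Finset.sum_filter, Finset.mul_sum]
    refine (norm_sum_le _ _).trans (Finset.sum_le_sum fun i _ => ?_)
    rw [norm_smul, hcn, mul_comm]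
    split_ifs with h
    · exact mul_le_mul_of_nonneg_right (hoM _) (d.mass_nonneg n x i)
    · rw [hoL _ (by omega), norm_zero]; simp
  · intro k hk
    rw [lp.coeFn_sum, Finset.sum_apply]
    refine Finset.sum_eq_zero fun i _ => ?_
    have := hlt i
    rw [lp.coeFn_smul, Pi.smul_apply, single_one_apply, if_neg, smul_zero]
    rw [b_succ] at hk
    omega
  · intro i hi
    rw [lp.coeFn_sum, Finset.sum_apply, Finset.sum_eq_single i]
    · rw [lp.coeFn_smul, Pi.smul_apply, single_one_apply, if_pos rfl, smul_eq_mul, mul_one,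
        norm_mul (c i), hcn, norm_mul, hs, one_mul]
    · intro i' hi' hne
      rw [lp.coeFn_smul, Pi.smul_apply, single_one_apply, if_neg, smul_zero]
      intro h
      have h2 : (i + j) % d.blockLen n = (i' + j) % d.blockLen n := by omega
      have h3 : i ≡ i' [MOD d.blockLen n] := Nat.ModEq.add_right_cancel' j h2
      exact hne ((h3.eq_of_lt_of_lt hi (Finset.mem_range.1 hi')).symm)
    · intro h
      exact absurd (Finset.mem_range.2 hi) h

end IsOperator

end CTypeData

/-! ### The weights of C₊,₂-type -/

namespace CTypeData

/-- The exponent of `2` in the product of the first `q` weights of a block of length `D` with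
parameter `s`: it increases to `s`, stays there, decreases to `0` and increases again to `s`. -/
def height (s D q : ℕ) : ℤ :=
  (min q s : ℕ) - (min (q - (D - 3 * s - 1)) s : ℕ) + (min (q - (D - 2 * s - 1)) s : ℕ)

theorem prod_norm_cPlus2Weight {s D : ℕ} (h : 4 * s < D) {q : ℕ} (hq : q < D) :
    ∏ j ∈ Finset.range q, ‖cPlus2Weight s D (j + 1)‖ = (2 : ℝ) ^ height s D q := by
  induction q with
  | zero =>
    have : height s D 0 = 0 := by simp only [height]; omega
    simp [this]
  | succ q ih =>
    rw [Finset.prod_range_succ, ih (by omega), cPlus2Weight]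
    have h2 : (2 : ℝ) ≠ 0 := two_ne_zero
    split_ifs
    · have : height s D (q + 1) = height s D q + 1 := by simp only [height]; omega
      rw [this, zpow_add_one₀ h2]; simp
    · have : height s D (q + 1) = height s D q := by simp only [height]; omega
      rw [this]; simp
    · have : height s D (q + 1) = height s D q - 1 := by simp only [height]; omega
      rw [this, zpow_sub_one₀ h2]; simp
    · have : height s D (q + 1) = height s D q + 1 := by simp only [height]; omega
      rw [this, zpow_add_one₀ h2]; simp
    · have : height s D (q + 1) = height s D q := by simp only [height]; omega
      rw [this]; simp

theorem height_le {s D : ℕ} (h : 4 * s < D) (q : ℕ) : height s D q ≤ s := by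
  simp only [height]; omega

theorem height_le_self {s D : ℕ} (h : 4 * s < D) (q : ℕ) : height s D q ≤ q := by
  simp only [height]; omega

/-- The level `k` of a block number `n ∈ [2 ^ (k - 1), 2 ^ k)`, `n ≥ 1`. -/
def level (n : ℕ) : ℕ := Nat.log 2 n + 1

theorem one_le_level (n : ℕ) : 1 ≤ level n := Nat.succ_le_succ (Nat.zero_le _)

theorem two_pow_level_le {n : ℕ} (hn : 1 ≤ n) : 2 ^ (level n - 1) ≤ n :=
  Nat.pow_log_le_self 2 (by omega)

theorem lt_two_pow_level (n : ℕ) : n < 2 ^ level n := Nat.lt_pow_succ_log_self one_lt_two n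

theorem level_eq {k n : ℕ} (hk : 1 ≤ k) (h1 : 2 ^ (k - 1) ≤ n) (h2 : n < 2 ^ k) : level n = k := by
  have : Nat.log 2 n = k - 1 := by
    rw [Nat.log_eq_iff (Or.inr ⟨one_lt_two, by have := Nat.two_pow_pos (k - 1); omega⟩)]
    exact ⟨h1, by rwa [Nat.sub_add_cancel hk]⟩
  rw [level, this]; omega

theorem level_sub_le {n : ℕ} (h : 1 ≤ n - 2 ^ (level n - 1)) :
    level (n - 2 ^ (level n - 1)) ≤ level n - 1 := by
  have h2 := lt_two_pow_level n
  have h3 : level n = level n - 1 + 1 := by have := one_le_level n; omega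
  rw [h3, pow_succ] at h2
  have h4 : n - 2 ^ (level n - 1) < 2 ^ (level n - 1) := by omega
  have := (Nat.pow_lt_pow_iff_right one_lt_two).1 ((two_pow_level_le h).trans_lt h4)
  omega

namespace IsCPlus2Type

variable {d : CTypeData} {τ : ℕ → ℤ} {δ Δ : ℕ → ℕ}

theorem blockLen_eq (hd : d.IsCPlus2Type τ δ Δ) {n : ℕ} (hn : 1 ≤ n) :
    d.blockLen n = Δ (level n) :=
  hd.isCPlusType.b_eq _ (one_le_level n) n (two_pow_level_le hn) (lt_two_pow_level n)

theorem four_mul_lt_level (hd : d.IsCPlus2Type τ δ Δ) (n : ℕ) :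
    4 * δ (level n) < Δ (level n) := hd.four_mul_lt _ (one_le_level n)

theorem norm_partialProd (hd : d.IsCPlus2Type τ δ Δ) {n q : ℕ} (hn : 1 ≤ n)
    (hq : q < Δ (level n)) :
    ‖d.partialProd n q‖ = (2 : ℝ) ^ height (δ (level n)) (Δ (level n)) q := by
  rw [← prod_norm_cPlus2Weight (hd.four_mul_lt_level n) hq, partialProd, norm_prod]
  refine Finset.prod_congr rfl fun j hj => ?_
  rw [hd.isCPlusType.w_eq _ (one_le_level n) n (two_pow_level_le hn) (lt_two_pow_level n) (j + 1)
    (by omega) (by have := Finset.mem_range.1 hj; omega)]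

theorem norm_blockProd (hd : d.IsCPlus2Type τ δ Δ) {n : ℕ} (hn : 1 ≤ n) :
    ‖d.blockProd n‖ = (2 : ℝ) ^ (δ (level n) : ℤ) := by
  have h4 := hd.four_mul_lt_level n
  rw [blockProd_eq, hd.blockLen_eq hn, hd.norm_partialProd hn (by omega)]
  congr 1
  simp only [height]; omega

theorem norm_coupling (hd : d.IsCPlus2Type τ δ Δ) {n : ℕ} (hn : 1 ≤ n) :
    ‖d.coupling n‖ = (2 : ℝ) ^ ((δ (level n) : ℤ) - τ (level n)) := by
  rw [coupling, if_neg (by omega), norm_mul, hd.norm_blockProd hn,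
    hd.isCPlusType.v_eq _ (one_le_level n) n (two_pow_level_le hn) (lt_two_pow_level n),
    norm_zpow, sub_eq_add_neg, zpow_add₀ two_ne_zero]
  simp

theorem δ_mono (hd : d.IsCPlus2Type τ δ Δ) {i j : ℕ} (hi : 1 ≤ i) (hij : i ≤ j) : δ i ≤ δ j :=
  hd.δ_strictMono.monotoneOn hi (hi.trans hij) hij

theorem le_δ (hd : d.IsCPlus2Type τ δ Δ) (k : ℕ) : k ≤ δ (k + 1) := by
  induction k with
  | zero => exact Nat.zero_le _
  | succ k ih =>
    have := hd.δ_strictMono (show 1 ≤ k + 1 by omega) (show 1 ≤ k + 1 + 1 by omega)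
      (Nat.lt_succ_self _)
    omega

theorem tendsto_δ (hd : d.IsCPlus2Type τ δ Δ) : Tendsto δ atTop atTop :=
  (tendsto_add_atTop_iff_nat 1).1 (tendsto_atTop_mono hd.le_δ tendsto_id)

theorem φ_eq (hd : d.IsCPlus2Type τ δ Δ) {n : ℕ} (hn : 1 ≤ n) :
    d.φ n = n - 2 ^ (level n - 1) :=
  hd.isCPlusType.φ_eq _ (one_le_level n) n (two_pow_level_le hn) (lt_two_pow_level n)

/-- A block feeds only blocks of smaller level, and the block number `0`. -/
theorem level_φ_le (hd : d.IsCPlus2Type τ δ Δ) {n : ℕ} (hn : 1 ≤ n) (hφ : 1 ≤ d.φ n) :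
    level (d.φ n) ≤ level n - 1 := by
  rw [hd.φ_eq hn] at hφ ⊢
  exact level_sub_le hφ

/-- Uniform bound for the orbits of the first vectors of the blocks that a block of level `k`
feeds. The weights of the block number `0` are arbitrary, and its contribution is absorbed in the
constant `R`. -/
theorem exists_norm_pow_apply_le (hd : d.IsCPlus2Type τ δ Δ) {p : ℝ≥0∞} [Fact (1 ≤ p)]
    {T : lp (fun _ : ℕ => ℂ) p →L[ℂ] lp (fun _ : ℕ => ℂ) p} (hT : d.IsOperator p T)
    (hγ : ∀ k, 1 ≤ k → (2 : ℝ) ^ ((δ (k - 1) : ℤ) - τ k) ≤ 1 / 2) :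
    ∃ R : ℝ, 1 ≤ R ∧ ∀ n, 1 ≤ n → ∀ j, ‖(T ^ j) (lp.single p (d.b (d.φ n)) 1)‖ ≤
      R * (2 : ℝ) ^ (δ (level n - 1) : ℤ) := by
  obtain ⟨M, hM⟩ := _root_.exists_norm_pow_apply_le
    (by have := d.blockLen_pos 0; omega : 0 < 2 * d.blockLen 0) (hT.pow_two_mul_len_apply_start 0)
  set R := max 2 M
  have hR2 : 2 ≤ R := le_max_left _ _
  have hRM : M ≤ R := le_max_right _ _
  have one_le : ∀ s : ℕ, (1 : ℝ) ≤ (2 : ℝ) ^ (s : ℤ) := fun s => by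
    rw [zpow_natCast]; exact one_le_pow₀ one_le_two
  have hstep : ∀ n, 1 ≤ n → (∀ m, 1 ≤ m → m < n → ∀ j, ‖(T ^ j) (lp.single p (d.b m) 1)‖ ≤
      R * (2 : ℝ) ^ (δ (level m) : ℤ)) → ∀ j, ‖(T ^ j) (lp.single p (d.b (d.φ n)) 1)‖ ≤
      R * (2 : ℝ) ^ (δ (level n - 1) : ℤ) := by
    intro n hn ih j
    rcases Nat.eq_zero_or_pos (d.φ n) with h0 | hφ
    · rw [h0]
      exact (hM j).trans (hRM.trans (le_mul_of_one_le_right (by linarith) (one_le _)))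
    · refine (ih _ hφ (d.φ_lt n hn) j).trans ?_
      gcongr
      · exact one_le_two
      · exact_mod_cast hd.δ_mono (one_le_level _) (hd.level_φ_le hn hφ)
  have hmain : ∀ n, 1 ≤ n → ∀ j, ‖(T ^ j) (lp.single p (d.b n) 1)‖ ≤
      R * (2 : ℝ) ^ (δ (level n) : ℤ) := by
    intro n
    induction n using Nat.strong_induction_on with
    | _ n ih =>
      intro hn j
      obtain ⟨s, o, hs, hTj, -, -, ho⟩ := hT.exists_pow_apply_start n j
        (hstep n hn fun m hm hmn => ih m hmn hm)
      have hq : j % d.blockLen n < Δ (level n) := by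
        rw [← hd.blockLen_eq hn]; exact Nat.mod_lt _ (d.blockLen_pos n)
      have h1 : ‖d.partialProd n (j % d.blockLen n)‖ ≤ (2 : ℝ) ^ (δ (level n) : ℤ) := by
        rw [hd.norm_partialProd hn hq]
        exact zpow_le_zpow_right₀ one_le_two (height_le (hd.four_mul_lt_level n) _)
      have h2 : ‖d.coupling n‖ * (R * (2 : ℝ) ^ (δ (level n - 1) : ℤ)) =
          (2 : ℝ) ^ (δ (level n) : ℤ) *
            (R * (2 : ℝ) ^ ((δ (level n - 1) : ℤ) - τ (level n))) := by
        rw [hd.norm_coupling hn, sub_eq_add_neg, sub_eq_add_neg, zpow_add₀ two_ne_zero,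
          zpow_add₀ two_ne_zero]
        ring
      have h3 := hγ _ (one_le_level n)
      have h4 : (0 : ℝ) < (2 : ℝ) ^ (δ (level n) : ℤ) := by positivity
      rw [hTj]
      calc _ ≤ ‖d.partialProd n (j % d.blockLen n)‖ + ‖o‖ := by
            refine (norm_add_le _ _).trans ?_
            rw [norm_smul, norm_mul, hs, one_mul, norm_single_one, mul_one]
        _ ≤ (2 : ℝ) ^ (δ (level n) : ℤ) + (2 : ℝ) ^ (δ (level n) : ℤ) * (R * (1 / 2)) := by
            refine add_le_add h1 (ho.trans (h2.le.trans ?_))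
            gcongr
        _ ≤ R * (2 : ℝ) ^ (δ (level n) : ℤ) := by nlinarith
  exact ⟨R, by linarith, fun n hn => hstep n hn fun m hm _ => hmain m hm⟩

/-! ### Chaos and `𝒰`-frequent hypercyclicity -/

/-- Small vectors whose orbits, from the time `m k = D * (2 * δ k / D)` on, follow the orbit of a
given finitely supported vector `x` during a time proportional to `m k`. The time `m k` is the
largest multiple of `D` not exceeding `2 * δ k`. -/
theorem exists_approx (hd : d.IsCPlus2Type τ δ Δ) {p : ℝ≥0∞} [Fact (1 ≤ p)]
    {T : lp (fun _ : ℕ => ℂ) p →L[ℂ] lp (fun _ : ℕ => ℂ) p} (hT : d.IsOperator p T)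
    {η : ℝ} (hη : 0 < η) (hη1 : η ≤ 1) (hτ : ∀ᶠ k in atTop, (τ k : ℝ) ≤ (1 - η) * δ k)
    {D : ℕ} (hD : 0 < D) {x : lp (fun _ : ℕ => ℂ) p}
    (hx : x ∈ Submodule.span ℂ (Set.range fun k : ℕ =>
      (lp.single p k 1 : lp (fun _ : ℕ => ℂ) p))) :
    ∃ z : ℕ → lp (fun _ : ℕ => ℂ) p, Tendsto z atTop (𝓝 0) ∧
      ∀ ε : ℝ, 0 < ε → ∀ᶠ k in atTop, ∀ r : ℕ, (r : ℝ) ≤ η / 4 * (D * (2 * δ k / D) : ℕ) →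
        ‖(T ^ (D * (2 * δ k / D) + r)) (z k) - (T ^ r) x‖ ≤ ε := by
  set m : ℕ → ℕ := fun k => D * (2 * δ k / D) with hm
  -- the vectors with the required property form a subspace which is invariant under `T`
  set Q : lp (fun _ : ℕ => ℂ) p → Prop := fun x =>
    ∃ z : ℕ → lp (fun _ : ℕ => ℂ) p, Tendsto z atTop (𝓝 0) ∧
      ∀ ε : ℝ, 0 < ε → ∀ᶠ k in atTop, ∀ r : ℕ, (r : ℝ) ≤ η / 4 * m k →
        ‖(T ^ (m k + r)) (z k) - (T ^ r) x‖ ≤ ε with hQ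
  have hsmul : ∀ (a : ℂ) (x), Q x → Q (a • x) := by
    rintro a x ⟨z, hz, h⟩
    refine ⟨fun k => a • z k, by simpa using hz.const_smul a, fun ε hε => ?_⟩
    filter_upwards [h (ε / (‖a‖ + 1)) (by positivity)] with k hk r hr
    rw [map_smul, map_smul, ← smul_sub, norm_smul]
    calc ‖a‖ * _ ≤ (‖a‖ + 1) * (ε / (‖a‖ + 1)) := by
          gcongr
          · linarith
          · exact hk r hr
      _ = ε := by field_simp
  have hTQ : ∀ x, Q x → Q (T x) := by
    rintro x ⟨z, hz, h⟩
    refine ⟨fun k => T (z k),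
      by simpa [Function.comp_def] using (T.continuous.tendsto 0).comp hz, fun ε hε => ?_⟩
    filter_upwards [h (ε / (‖T‖ + 1)) (by positivity)] with k hk r hr
    rw [← mul_apply_eq_comp, ← mul_apply_eq_comp, ← pow_succ, pow_succ', mul_apply_eq_comp,
      ← pow_succ, pow_succ', mul_apply_eq_comp, ← map_sub]
    calc _ ≤ ‖T‖ * _ := T.le_opNorm _
      _ ≤ (‖T‖ + 1) * (ε / (‖T‖ + 1)) := by
          gcongr
          · linarith
          · exact hk r hr
      _ = ε := by field_simp
  have hδ : Tendsto (fun k => (δ k : ℝ)) atTop atTop :=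
    tendsto_natCast_atTop_atTop.comp hd.tendsto_δ
  have hsmall : ∀ ε : ℝ, 0 < ε → ∃ E : ℕ, ∀ e : ℤ, (e : ℝ) ≤ -E → (2 : ℝ) ^ e ≤ ε := by
    intro ε hε
    obtain ⟨E, hE⟩ := exists_pow_lt_of_lt_one hε (by norm_num : (1 / 2 : ℝ) < 1)
    refine ⟨E, fun e he => ?_⟩
    have he' : e ≤ -E := by exact_mod_cast he
    calc (2 : ℝ) ^ e ≤ (2 : ℝ) ^ (-E : ℤ) := zpow_le_zpow_right₀ one_le_two he'
      _ = (1 / 2 : ℝ) ^ E := by rw [zpow_neg, zpow_natCast, one_div, inv_pow]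
      _ ≤ ε := hE.le
  have hbase : ∀ l, Q (lp.single p (d.b l) 1) := by
    intro l
    have hlt : ∀ᶠ k in atTop, 1 ≤ k ∧ l < 2 ^ (k - 1) := by
      filter_upwards [eventually_ge_atTop (l + 1)] with k hk
      exact ⟨by omega, Nat.lt_two_pow_self.trans_le (Nat.pow_le_pow_right two_pos (by omega))⟩
    have hfacts : ∀ k, 1 ≤ k → l < 2 ^ (k - 1) → 1 ≤ 2 ^ (k - 1) + l ∧
        level (2 ^ (k - 1) + l) = k ∧ d.φ (2 ^ (k - 1) + l) = l := by
      intro k hk hl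
      have hpos : 1 ≤ 2 ^ (k - 1) + l := by omega
      have hpow : 2 ^ k = 2 ^ (k - 1) * 2 := by rw [← pow_succ, Nat.sub_add_cancel hk]
      have hlev : level (2 ^ (k - 1) + l) = k := level_eq hk (by omega) (by omega)
      refine ⟨hpos, hlev, ?_⟩
      rw [hd.φ_eq hpos, hlev]; omega
    have hmle : ∀ k, m k ≤ 2 * δ k := fun k => Nat.mul_div_le _ _
    have hmlt : ∀ k, 2 * δ k < m k + D := fun k => Nat.lt_mul_div_succ _ hD
    -- The block number `n = 2 ^ (k - 1) + l` feeds the `l`-th one, and a multiple of its vector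
    -- number `Δ k - m k` is mapped by `T ^ m k` to `e_{b_l} - (coupling n)⁻¹ • e_{b_n}`. It is small
    -- since the partial products are about `1` there, and the second term takes a time
    -- comparable to `δ k - τ k` to become large.
    refine ⟨fun k => (d.coupling (2 ^ (k - 1) + l))⁻¹ •
      (T ^ (Δ k - m k)) (lp.single p (d.b (2 ^ (k - 1) + l)) 1), ?_, ?_⟩
    · rw [NormedAddGroup.tendsto_nhds_zero]
      intro ε hε
      obtain ⟨E, hE⟩ := hsmall (ε / 2) (by positivity)
      filter_upwards [hlt, hτ, hδ.eventually_ge_atTop ((E + D) / η),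
        hd.tendsto_δ.eventually_ge_atTop D] with k ⟨hk, hl⟩ hτk hδk hDk
      obtain ⟨hn, hlev, -⟩ := hfacts k hk hl
      have h4 := hd.four_mul_lt k hk
      have h5 := hmle k
      have h6 := hmlt k
      have hq : Δ k - m k < Δ k := by omega
      have hκ := hd.norm_coupling hn
      have hW := hd.norm_partialProd (q := Δ k - m k) hn (by rwa [hlev])
      rw [hlev] at hκ hW
      rw [norm_smul, norm_inv, hT.pow_apply_start _ (by rwa [hd.blockLen_eq hn, hlev]), norm_smul,
        norm_single_one, mul_one, hκ, hW, ← zpow_neg, ← zpow_add₀ two_ne_zero]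
      have hh : height (δ k) (Δ k) (Δ k - m k) ≤ D := by
        simp only [height]; omega
      refine (hE _ ?_).trans_lt (by linarith)
      push_cast
      have hh' : (height (δ k) (Δ k) (Δ k - m k) : ℝ) ≤ D := by exact_mod_cast hh
      rw [div_le_iff₀ hη] at hδk
      linarith
    · intro ε hε
      obtain ⟨E, hE⟩ := hsmall ε hε
      filter_upwards [hlt, hτ, hδ.eventually_ge_atTop (2 * E / η)] with k ⟨hk, hl⟩ hτk hδk r hr
      obtain ⟨hn, hlev, hφ⟩ := hfacts k hk hl
      have h4 := hd.four_mul_lt k hk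
      have h5 := hmle k
      have hr' : (r : ℝ) ≤ η / 2 * δ k := by
        have : (m k : ℝ) ≤ 2 * δ k := by exact_mod_cast h5
        nlinarith
      have hrδ : r ≤ δ k := by
        have : (r : ℝ) ≤ δ k := by nlinarith [(δ k).cast_nonneg (α := ℝ)]
        exact_mod_cast this
      have hκ := hd.norm_coupling hn
      have hW := hd.norm_partialProd (q := r) hn (by rw [hlev]; omega)
      rw [hlev] at hκ hW
      have hκ0 : d.coupling (2 ^ (k - 1) + l) ≠ 0 := by
        rw [← norm_pos_iff, hκ]; positivity
      have e1 : m k + r + (Δ k - m k) = d.blockLen (2 ^ (k - 1) + l) + r := by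
        rw [hd.blockLen_eq hn, hlev]; omega
      rw [map_smul, ← mul_apply_eq_comp, ← pow_add, e1, hT.pow_len_add_apply_start, hφ, smul_sub,
        smul_smul, inv_mul_cancel₀ hκ0, one_smul, sub_sub_cancel_left, norm_neg, norm_smul,
        norm_inv, hT.pow_apply_start _ (by rw [hd.blockLen_eq hn, hlev]; omega), norm_smul,
        norm_single_one, mul_one, hκ, hW, ← zpow_neg, ← zpow_add₀ two_ne_zero]
      have hh : (height (δ k) (Δ k) r : ℝ) ≤ r := by exact_mod_cast height_le_self h4 r
      refine hE _ ?_
      push_cast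
      rw [div_le_iff₀ hη] at hδk
      linarith
  change Q x
  induction hx using Submodule.span_induction with
  | mem x hx =>
    obtain ⟨k, rfl⟩ := hx
    obtain ⟨n, i, hi, rfl⟩ := d.exists_block k
    simp only
    rw [hT.single_eq n hi]
    refine hsmul _ _ ?_
    clear hi
    induction i with
    | zero => exact hbase n
    | succ i ih => rw [pow_succ', mul_apply_eq_comp]; exact hTQ _ ih
  | zero => exact ⟨fun _ => 0, tendsto_const_nhds, fun ε hε => by simp [hε.le]⟩
  | add x y _ _ hx hy =>
    obtain ⟨z, hz, h⟩ := hx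
    obtain ⟨z', hz', h'⟩ := hy
    refine ⟨fun k => z k + z' k, by simpa using hz.add hz', fun ε hε => ?_⟩
    filter_upwards [h (ε / 2) (by positivity), h' (ε / 2) (by positivity)] with k hk hk' r hr
    rw [map_add, map_add, add_sub_add_comm]
    refine (norm_add_le _ _).trans ?_
    linarith [hk r hr, hk' r hr]
  | smul a x _ hx => exact hsmul a x hx

theorem isUFrequentlyHypercyclic (hd : d.IsCPlus2Type τ δ Δ) {p : ℝ≥0∞} [Fact (1 ≤ p)]
    (hp : p ≠ ∞) {T : lp (fun _ : ℕ => ℂ) p →L[ℂ] lp (fun _ : ℕ => ℂ) p}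
    (hT : d.IsOperator p T) {η : ℝ} (hη : 0 < η) (hη1 : η ≤ 1)
    (hτ : ∀ᶠ k in atTop, (τ k : ℝ) ≤ (1 - η) * δ k) : IsUFrequentlyHypercyclic T := by
  have := separableSpace_lp (p := p) hp
  refine isUFrequentlyHypercyclic_of_periodic T _ (dense_span_single hp)
    (fun x hx => hT.mem_periodicPts_of_mem_span hx) (by positivity : 0 < η / 4) ?_
  intro x hx D hD ε hε N
  obtain ⟨z, hz, h⟩ := hd.exists_approx hT hη hη1 hτ hD hx
  obtain ⟨k, hk1, hk2, hk3⟩ := ((NormedAddGroup.tendsto_nhds_zero.1 hz ε hε).and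
    ((h (ε / 2) (by positivity)).and (hd.tendsto_δ.eventually_ge_atTop (N + D)))).exists
  refine ⟨z k, D * (2 * δ k / D), ?_, dvd_mul_right _ _, hk1, fun r hr =>
    (hk2 r hr).trans_lt (by linarith)⟩
  have := Nat.lt_mul_div_succ (2 * δ k) hD
  rw [mul_add] at this
  omega

theorem isChaotic (hd : d.IsCPlus2Type τ δ Δ) {p : ℝ≥0∞} [Fact (1 ≤ p)]
    (hp : p ≠ ∞) {T : lp (fun _ : ℕ => ℂ) p →L[ℂ] lp (fun _ : ℕ => ℂ) p}
    (hT : d.IsOperator p T) {η : ℝ} (hη : 0 < η) (hη1 : η ≤ 1)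
    (hτ : ∀ᶠ k in atTop, (τ k : ℝ) ≤ (1 - η) * δ k) : IsChaotic T :=
  ⟨(hd.isUFrequentlyHypercyclic hp hT hη hη1 hτ).isHypercyclic,
    (dense_span_single hp).mono fun _ hx => hT.mem_periodicPts_of_mem_span hx⟩

end IsCPlus2Type

end CTypeData

/-! ### Counting lemmas -/

/-- A set of `#B` residues modulo `L` is visited at most `#B` times per period. -/
theorem card_filter_add_mod_mem_le {L : ℕ} (hL : 0 < L) (B : Finset ℕ) (i J : ℕ) :
    ((Finset.range (J + 1)).filter fun j => (i + j) % L ∈ B).card ≤ B.card * (J / L + 2) := by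
  have h := Finset.card_le_card_of_injOn
    (s := (Finset.range (J + 1)).filter fun j => (i + j) % L ∈ B)
    (t := B ×ˢ Finset.range (J / L + 2))
    (fun j => ((i + j) % L, (i + j) / L - i / L)) ?_ ?_
  · rwa [Finset.card_product, Finset.card_range] at h
  · intro j hj
    rw [Finset.mem_coe, Finset.mem_filter, Finset.mem_range] at hj
    rw [Finset.mem_coe, Finset.mem_product, Finset.mem_range]
    refine ⟨hj.2, ?_⟩
    have h1 : (i + j) / L ≤ (i + J) / L := Nat.div_le_div_right (by omega)
    have h2 : (i + J) / L ≤ i / L + J / L + 1 := by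
      rw [Nat.add_div hL]
      split_ifs <;> omega
    have h3 : i / L ≤ (i + j) / L := Nat.div_le_div_right (by omega)
    have h4 := Nat.zero_le (J / L)
    simp only
    omega
  · intro j _ j' _ h
    simp only [Prod.mk.injEq] at h
    have h1 : i / L ≤ (i + j) / L := Nat.div_le_div_right (by omega)
    have h2 : i / L ≤ (i + j') / L := Nat.div_le_div_right (by omega)
    have h3 : (i + j) / L = (i + j') / L := by omega
    have h4 := Nat.mod_add_div (i + j) L
    rw [h.1, h3, Nat.mod_add_div] at h4
    omega

/-- A Markov inequality: if each index is bad at no more than `N` times of `F`, then no more than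
`2 N` times of `F` are such that the bad indices carry half of the total mass. -/
theorem card_le_of_half_le_sum_bad (I F : Finset ℕ) (g : ℕ → ℝ) (hg : ∀ i, 0 ≤ g i)
    (bad : ℕ → ℕ → Prop) [∀ i j, Decidable (bad i j)] (N : ℕ) (hσ : 0 < ∑ i ∈ I, g i)
    (hF : ∀ j ∈ F, (∑ i ∈ I, g i) / 2 ≤ ∑ i ∈ I.filter fun i => bad i j, g i)
    (hN : ∀ i ∈ I, (F.filter fun j => bad i j).card ≤ N) : (F.card : ℝ) ≤ 2 * N := by
  have h1 : (F.card : ℝ) * ((∑ i ∈ I, g i) / 2) ≤ N * ∑ i ∈ I, g i := by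
    calc (F.card : ℝ) * ((∑ i ∈ I, g i) / 2) = ∑ j ∈ F, (∑ i ∈ I, g i) / 2 := by
          rw [Finset.sum_const, nsmul_eq_mul]
      _ ≤ ∑ j ∈ F, ∑ i ∈ I.filter fun i => bad i j, g i := Finset.sum_le_sum hF
      _ = ∑ i ∈ I, ∑ j ∈ F.filter fun j => bad i j, g i := by
          simp only [Finset.sum_filter]
          exact Finset.sum_comm
      _ = ∑ i ∈ I, ((F.filter fun j => bad i j).card : ℝ) * g i := by
          simp only [Finset.sum_const, nsmul_eq_mul]
      _ ≤ ∑ i ∈ I, (N : ℝ) * g i := Finset.sum_le_sum fun i hi =>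
          mul_le_mul_of_nonneg_right (by exact_mod_cast hN i hi) (hg i)
      _ = N * ∑ i ∈ I, g i := (Finset.mul_sum _ _ _).symm
  nlinarith

namespace CTypeData

/-! ### Leaks between blocks -/

variable {d : CTypeData} {p : ℝ≥0∞}

theorem leakedMass_le (d : CTypeData) (n : ℕ) (x : lp (fun _ : ℕ => ℂ) p) (J : ℕ) :
    d.leakedMass n x J ≤ ∑ i ∈ Finset.range (d.blockLen n), d.mass n x i :=
  Finset.sum_le_sum_of_subset_of_nonneg (Finset.filter_subset _ _)
    fun i _ _ => d.mass_nonneg n x i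

theorem leakedMass_nonneg (d : CTypeData) (n : ℕ) (x : lp (fun _ : ℕ => ℂ) p) (J : ℕ) :
    0 ≤ d.leakedMass n x J := Finset.sum_nonneg fun i _ => d.mass_nonneg n x i

theorem IsCPlus2Type.gammaSeq_pos {τ : ℕ → ℤ} {δ Δ : ℕ → ℕ} (hd : d.IsCPlus2Type τ δ Δ) {k : ℕ}
    (hk : 1 ≤ k) :
    0 < gammaSeq p τ δ Δ k := by
  have : (0 : ℝ) < Δ k := by exact_mod_cast (Nat.zero_le _).trans_lt (hd.four_mul_lt k hk)
  rw [gammaSeq]; positivity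

theorem IsCPlus2Type.coupling_mul_eq {τ : ℕ → ℤ} {δ Δ : ℕ → ℕ} (hd : d.IsCPlus2Type τ δ Δ) {n : ℕ}
    (hn : 1 ≤ n) (R : ℝ) :
    ‖d.coupling n‖ * (R * (2 : ℝ) ^ (δ (level n - 1) : ℤ)) * (Δ (level n) : ℝ) ^ (1 - 1 / p.toReal)
      = R * gammaSeq p τ δ Δ (level n) * (2 : ℝ) ^ (δ (level n) : ℤ) := by
  rw [hd.norm_coupling hn, gammaSeq, sub_eq_add_neg, sub_eq_add_neg (δ (level n - 1) : ℤ),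
    zpow_add₀ two_ne_zero, zpow_add₀ two_ne_zero]
  ring

variable [Fact (1 ≤ p)]

theorem tendsto_sum_mass (d : CTypeData) (n : ℕ) :
    Tendsto (fun x : lp (fun _ : ℕ => ℂ) p =>
      ∑ i ∈ Finset.range (d.blockLen n), d.mass n x i) (𝓝 0) (𝓝 0) := by
  have : Continuous fun x : lp (fun _ : ℕ => ℂ) p =>
      ∑ i ∈ Finset.range (d.blockLen n), d.mass n x i := by
    refine continuous_finsetSum _ fun i _ => ?_
    exact (continuous_norm.comp
      (lp.evalCLM ℂ (fun _ : ℕ => ℂ) p (d.b n + i)).continuous).div_const _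
  convert this.tendsto 0 using 2
  symm
  refine Finset.sum_eq_zero fun i _ => ?_
  simp [mass]

namespace IsOperator

variable {T : lp (fun _ : ℕ => ℂ) p →L[ℂ] lp (fun _ : ℕ => ℂ) p}

theorem norm_pow_apply_blockPart_le (hT : d.IsOperator p T) (n : ℕ) {M : ℝ}
    (hM : ∀ j, ‖(T ^ j) (lp.single p (d.b n) 1)‖ ≤ M) (x : lp (fun _ : ℕ => ℂ) p) (j : ℕ) :
    ‖(T ^ j) (d.blockPart n x)‖ ≤ M * ∑ i ∈ Finset.range (d.blockLen n), d.mass n x i := by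
  rw [blockPart, map_sum, Finset.mul_sum]
  refine (norm_sum_le _ _).trans (Finset.sum_le_sum fun i hi => ?_)
  rw [map_smul, hT.single_eq n (Finset.mem_range.1 hi), map_smul, ← mul_apply_eq_comp, ← pow_add,
    norm_smul, norm_smul, norm_inv, ← mul_assoc, ← div_eq_mul_inv, mul_comm, mass]
  exact mul_le_mul_of_nonneg_right (hM _) (div_nonneg (norm_nonneg _) (norm_nonneg _))

/-- If up to time `J` every block after the `n`-th one leaks little, then up to time `J` the
`n`-th block of `T ^ j x` is a small perturbation of what comes from the `n`-th block of `x`. -/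
theorem exists_pow_apply_eq_add (hT : d.IsOperator p T) (hp : p ≠ ∞) {M : ℕ → ℝ}
    (hM : ∀ n j, ‖(T ^ j) (lp.single p (d.b (d.φ n)) 1)‖ ≤ M n) {β : ℕ → ℝ} (hβ0 : ∀ n, 0 ≤ β n)
    (hβ : Summable β) (x : lp (fun _ : ℕ => ℂ) p) (n : ℕ) {j J : ℕ} (hj : j ≤ J)
    (hno : ∀ l, n < l → ‖d.coupling l‖ * M l * d.leakedMass l x J ≤ β l) :
    ∃ w : lp (fun _ : ℕ => ℂ) p, ‖w‖ ≤ ∑' l, β l ∧ ∀ k, d.b n ≤ k → k < d.b (n + 1) →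
      (T ^ j) x k = (T ^ j) (d.blockPart n x) k + w k := by
  choose A O hAO hO hOn hA _ using fun l => hT.exists_pow_apply_blockPart l (hM l) x hj
  set W : ℕ → lp (fun _ : ℕ => ℂ) p := fun l => if n < l then O l else 0 with hW
  have hWβ : ∀ l, ‖W l‖ ≤ β l := by
    intro l
    simp only [hW]
    split_ifs with h
    · exact (hOn l).trans (hno l h)
    · rw [norm_zero]; exact hβ0 l
  have hWs : Summable W := Summable.of_norm_bounded hβ hWβ
  refine ⟨∑' l, W l, tsum_of_norm_bounded hβ.hasSum hWβ, fun k hk1 hk2 => ?_⟩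
  have h1 : HasSum (fun l => (T ^ j) (d.blockPart l x) k) ((T ^ j) x k) :=
    ((d.hasSum_blocks hp x).mapL (T ^ j)).mapL (lp.evalCLM ℂ (fun _ : ℕ => ℂ) p k)
  have h2 : HasSum (fun l => W l k) ((∑' l, W l : lp (fun _ : ℕ => ℂ) p) k) :=
    hWs.hasSum.mapL (lp.evalCLM ℂ (fun _ : ℕ => ℂ) p k)
  have h3 := (hasSum_ite_eq n ((T ^ j) (d.blockPart n x) k)).add h2
  refine h1.unique (h3.congr_fun fun l => ?_)
  rcases Nat.lt_trichotomy l n with h | rfl | h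
  · have hb := d.b_strictMono.monotone (Nat.succ_le_of_lt h)
    have hb' := d.b_strictMono.monotone h.le
    simp only [hW]
    rw [if_neg h.ne, if_neg (by omega), hAO, lp.coeFn_add, Pi.add_apply, hA l k (Or.inr
      (hb.trans hk1)), hO l k (hb'.trans hk1)]
    simp
  · simp [hW]
  · have hb := d.b_strictMono.monotone (Nat.succ_le_of_lt h)
    simp only [hW]
    rw [if_neg h.ne', if_pos h, hAO, lp.coeFn_add, Pi.add_apply, hA l k (Or.inl
      (hk2.trans_le hb))]

theorem norm_pow_apply_blockPart_apply (hT : d.IsOperator p T) {n : ℕ} {M : ℝ}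
    (hM : ∀ j, ‖(T ^ j) (lp.single p (d.b (d.φ n)) 1)‖ ≤ M) (x : lp (fun _ : ℕ => ℂ) p)
    (j : ℕ) {i : ℕ} (hi : i < d.blockLen n) :
    ‖(T ^ j) (d.blockPart n x) (d.b n + (i + j) % d.blockLen n)‖ =
        d.mass n x i * ‖d.partialProd n ((i + j) % d.blockLen n)‖ := by
  obtain ⟨A, O, hAO, hO, -, -, h⟩ := hT.exists_pow_apply_blockPart n hM x le_rfl
  rw [hAO, lp.coeFn_add, Pi.add_apply, hO _ (by omega), add_zero, h i hi]

/-- The mass that has come back to the positions `q` with `‖w_{b_n + 1} ⋯ w_{b_n + q}‖ ≥ P` is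
seen by the `ℓ₁`-norm of the `n`-th block of the orbit. -/
theorem mul_sum_mass_le (hT : d.IsOperator p T) {n : ℕ} {M P : ℝ}
    (hM : ∀ j, ‖(T ^ j) (lp.single p (d.b (d.φ n)) 1)‖ ≤ M) (x : lp (fun _ : ℕ => ℂ) p)
    (j : ℕ) {I : Finset ℕ} (hI : I ⊆ Finset.range (d.blockLen n))
    (hP : ∀ i ∈ I, P ≤ ‖d.partialProd n ((i + j) % d.blockLen n)‖) :
    P * ∑ i ∈ I, d.mass n x i ≤
      ∑ q ∈ Finset.range (d.blockLen n), ‖(T ^ j) (d.blockPart n x) (d.b n + q)‖ := by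
  have hinj : Set.InjOn (fun i => (i + j) % d.blockLen n) I := by
    intro i hi i' hi' h
    exact (Nat.ModEq.add_right_cancel' j h).eq_of_lt_of_lt (Finset.mem_range.1 (hI hi))
      (Finset.mem_range.1 (hI hi'))
  calc P * ∑ i ∈ I, d.mass n x i
      ≤ ∑ i ∈ I, ‖(T ^ j) (d.blockPart n x) (d.b n + (i + j) % d.blockLen n)‖ := by
        rw [Finset.mul_sum]
        refine Finset.sum_le_sum fun i hi => ?_
        rw [hT.norm_pow_apply_blockPart_apply hM x j (Finset.mem_range.1 (hI hi)), mul_comm]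
        exact mul_le_mul_of_nonneg_left (hP i hi) (d.mass_nonneg n x i)
    _ = ∑ q ∈ I.image fun i => (i + j) % d.blockLen n,
          ‖(T ^ j) (d.blockPart n x) (d.b n + q)‖ := by
        rw [Finset.sum_image hinj]
    _ ≤ _ := by
        refine Finset.sum_le_sum_of_subset_of_nonneg ?_ fun _ _ _ => norm_nonneg _
        intro q hq
        obtain ⟨i, -, rfl⟩ := Finset.mem_image.1 hq
        exact Finset.mem_range.2 (Nat.mod_lt _ (d.blockLen_pos n))

end IsOperator

/-! ### Failure of frequent hypercyclicity -/

/-- The positions `q` in a block of length `D` with parameter `s` where the product of the first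
`q` weights may be less than `2 ^ s`. -/
def lowPositions (s D : ℕ) : Finset ℕ := Finset.range s ∪ Finset.Ico (D - 3 * s) (D - s)

theorem card_lowPositions_le (s D : ℕ) : (lowPositions s D).card ≤ 3 * s := by
  refine (Finset.card_union_le _ _).trans ?_
  rw [Finset.card_range, Nat.card_Ico]
  omega

theorem height_eq {s D q : ℕ} (h : 4 * s < D) (hq : q ∉ lowPositions s D) :
    height s D q = s := by
  simp only [lowPositions, Finset.mem_union, Finset.mem_range, Finset.mem_Ico] at hq
  simp only [height]; omega

namespace IsCPlus2Type

variable {τ : ℕ → ℤ} {δ Δ : ℕ → ℕ} {T : lp (fun _ : ℕ => ℂ) p →L[ℂ] lp (fun _ : ℕ => ℂ) p}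

/-- Up to the time `δ (level n)` the `n`-th block leaks very little: the last `δ` weights of the
block are `1`, so the coordinates that leave it have not been amplified. -/
theorem coupling_mul_leakedMass_le (hd : d.IsCPlus2Type τ δ Δ) (hp : p ≠ ∞) {n : ℕ} (hn : 1 ≤ n)
    {R : ℝ} (hR : 0 ≤ R) (x : lp (fun _ : ℕ => ℂ) p) {J : ℕ} (hJ : J ≤ δ (level n)) :
    ‖d.coupling n‖ * (R * (2 : ℝ) ^ (δ (level n - 1) : ℤ)) * d.leakedMass n x J ≤
      R * gammaSeq p τ δ Δ (level n) * ‖x‖ := by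
  have hL := hd.blockLen_eq hn
  have h4 := hd.four_mul_lt_level n
  have h1 : d.leakedMass n x J ≤
      (Δ (level n) : ℝ) ^ (1 - 1 / p.toReal) * ‖x‖ / (2 : ℝ) ^ (δ (level n) : ℤ) := by
    calc d.leakedMass n x J
        ≤ ∑ i ∈ Finset.range (d.blockLen n), ‖x (d.b n + i)‖ / (2 : ℝ) ^ (δ (level n) : ℤ) := by
          rw [leakedMass, Finset.sum_filter]
          refine Finset.sum_le_sum fun i hi => ?_
          rw [Finset.mem_range, hL] at hi
          split_ifs with h
          · rw [hL] at h
            rw [mass, hd.norm_partialProd hn hi, height_eq h4]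
            simp only [lowPositions, Finset.mem_union, Finset.mem_range, Finset.mem_Ico]
            omega
          · positivity
      _ ≤ _ := by
          rw [← Finset.sum_div, ← hL]
          gcongr
          exact sum_norm_apply_le hp x _ _
  have h2 : (0 : ℝ) < (2 : ℝ) ^ (δ (level n) : ℤ) := by positivity
  calc _ ≤ ‖d.coupling n‖ * (R * (2 : ℝ) ^ (δ (level n - 1) : ℤ)) *
        ((Δ (level n) : ℝ) ^ (1 - 1 / p.toReal) * ‖x‖ / (2 : ℝ) ^ (δ (level n) : ℤ)) := by
        gcongr
    _ = (‖d.coupling n‖ * (R * (2 : ℝ) ^ (δ (level n - 1) : ℤ)) *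
        (Δ (level n) : ℝ) ^ (1 - 1 / p.toReal)) * ‖x‖ / (2 : ℝ) ^ (δ (level n) : ℤ) := by ring
    _ = _ := by
        rw [hd.coupling_mul_eq hn]
        field_simp

/-- If up to time `J` the `n`-th block has leaked significantly and the following ones have not,
then the orbit of `x` is large at most times up to `J`: the mass that leaks spends all but at most
`3 δ` steps of each turn at positions where it is not damped, and it is much larger there than its
trace in the lower blocks. -/
theorem card_le_of_leak (hd : d.IsCPlus2Type τ δ Δ) (hT : d.IsOperator p T) (hp : p ≠ ∞)
    {n : ℕ} (hn : 1 ≤ n) {R : ℝ} (hR : 0 ≤ R) {M : ℕ → ℝ}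
    (hM : ∀ n j, ‖(T ^ j) (lp.single p (d.b (d.φ n)) 1)‖ ≤ M n)
    (hMn : M n = R * (2 : ℝ) ^ (δ (level n - 1) : ℤ)) {β : ℕ → ℝ} (hβ0 : ∀ n, 0 ≤ β n)
    (hβ : Summable β) (hβn : β n = √(gammaSeq p τ δ Δ (level n))) {C : ℝ}
    (hC : 2 * R * (C + ∑' l, β l) * √(gammaSeq p τ δ Δ (level n)) ≤ 1)
    (x : lp (fun _ : ℕ => ℂ) p) {J : ℕ}
    (hno : ∀ l, n < l → ‖d.coupling l‖ * M l * d.leakedMass l x J ≤ β l)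
    (hleak : β n < ‖d.coupling n‖ * M n * d.leakedMass n x J)
    (F : Finset ℕ) (hF : F ⊆ Finset.range (J + 1)) (hFC : ∀ j ∈ F, ‖(T ^ j) x‖ ≤ C) :
    (F.card : ℝ) ≤ 2 * (3 * δ (level n) * (J / Δ (level n) + 2) : ℕ) := by
  classical
  have hL := hd.blockLen_eq hn
  have h4 := hd.four_mul_lt_level n
  have hκ : 0 ≤ ‖d.coupling n‖ * M n := by rw [hMn]; positivity
  have hγ := hd.gammaSeq_pos (p := p) (one_le_level n)
  have hσ : 0 < d.leakedMass n x J := by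
    by_contra h
    have h' : d.leakedMass n x J = 0 := le_antisymm (not_lt.1 h) (d.leakedMass_nonneg n x J)
    rw [h', mul_zero] at hleak
    exact absurd hleak (not_lt.2 (hβ0 n))
  refine card_le_of_half_le_sum_bad
    ((Finset.range (d.blockLen n)).filter fun i => d.blockLen n ≤ i + J) F (d.mass n x)
    (d.mass_nonneg n x)
    (fun i j => (i + j) % d.blockLen n ∈ lowPositions (δ (level n)) (Δ (level n))) _ hσ ?_ ?_
  · intro j hj
    by_contra hcon
    rw [not_le] at hcon
    have hjJ : j ≤ J := by have := Finset.mem_range.1 (hF hj); omega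
    set I := (Finset.range (d.blockLen n)).filter fun i => d.blockLen n ≤ i + J with hI
    set G := I.filter fun i =>
      ¬ (i + j) % d.blockLen n ∈ lowPositions (δ (level n)) (Δ (level n)) with hG
    have hGsum : d.leakedMass n x J / 2 ≤ ∑ i ∈ G, d.mass n x i := by
      have := Finset.sum_filter_add_sum_filter_not I
        (fun i => (i + j) % d.blockLen n ∈ lowPositions (δ (level n)) (Δ (level n)))
        (d.mass n x)
      have h2 : d.leakedMass n x J = ∑ i ∈ I, d.mass n x i := rfl
      rw [h2]
      linarith
    obtain ⟨w, hw, hTw⟩ := hT.exists_pow_apply_eq_add hp hM hβ0 hβ x n hjJ hno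
    -- otherwise at least half of the leaked mass `σ` is at positions where the partial product is
    -- `2 ^ δ`, which forces `2 ^ δ * σ / 2` to be at most the `ℓ₁`-norm of the `n`-th block of
    -- `T ^ j x`, up to the contribution of the following blocks; the latter is estimated by Hölder
    have h1 := hT.mul_sum_mass_le (hM n) x j (P := (2 : ℝ) ^ (δ (level n) : ℤ)) (I := G)
      ((Finset.filter_subset _ _).trans (Finset.filter_subset _ _)) (fun i hi => by
        rw [hd.norm_partialProd hn (by rw [← hL]; exact Nat.mod_lt _ (d.blockLen_pos n)),
          height_eq h4 (Finset.mem_filter.1 hi).2])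
    have h2 : ∑ q ∈ Finset.range (d.blockLen n), ‖(T ^ j) (d.blockPart n x) (d.b n + q)‖ ≤
        (Δ (level n) : ℝ) ^ (1 - 1 / p.toReal) * (C + ∑' l, β l) := by
      calc _ ≤ ∑ q ∈ Finset.range (d.blockLen n), (‖(T ^ j) x (d.b n + q)‖ + ‖w (d.b n + q)‖) := by
            refine Finset.sum_le_sum fun q hq => ?_
            have := hTw (d.b n + q) (by omega)
              (by rw [b_succ]; have := Finset.mem_range.1 hq; omega)
            rw [eq_sub_of_add_eq this.symm]
            exact norm_sub_le _ _
        _ ≤ (d.blockLen n : ℝ) ^ (1 - 1 / p.toReal) * ‖(T ^ j) x‖ +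
            (d.blockLen n : ℝ) ^ (1 - 1 / p.toReal) * ‖w‖ := by
            rw [Finset.sum_add_distrib]
            exact add_le_add (sum_norm_apply_le hp _ _ _) (sum_norm_apply_le hp _ _ _)
        _ ≤ _ := by
            rw [hL, ← mul_add]
            gcongr
            exact hFC j hj
    have h3 : (2 : ℝ) ^ (δ (level n) : ℤ) * d.leakedMass n x J ≤
        2 * ((Δ (level n) : ℝ) ^ (1 - 1 / p.toReal) * (C + ∑' l, β l)) := by
      have : (0 : ℝ) < (2 : ℝ) ^ (δ (level n) : ℤ) := by positivity
      nlinarith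
    have h5 : (2 : ℝ) ^ (δ (level n) : ℤ) * √(gammaSeq p τ δ Δ (level n)) <
        (2 : ℝ) ^ (δ (level n) : ℤ) * (2 * R * (C + ∑' l, β l) * gammaSeq p τ δ Δ (level n)) := by
      calc _ < (2 : ℝ) ^ (δ (level n) : ℤ) * (‖d.coupling n‖ * M n * d.leakedMass n x J) := by
            rw [hβn] at hleak
            gcongr
        _ = ‖d.coupling n‖ * M n * ((2 : ℝ) ^ (δ (level n) : ℤ) * d.leakedMass n x J) := by ring
        _ ≤ ‖d.coupling n‖ * M n *
            (2 * ((Δ (level n) : ℝ) ^ (1 - 1 / p.toReal) * (C + ∑' l, β l))) := by gcongr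
        _ = (‖d.coupling n‖ * (R * (2 : ℝ) ^ (δ (level n - 1) : ℤ)) *
              (Δ (level n) : ℝ) ^ (1 - 1 / p.toReal)) * (2 * (C + ∑' l, β l)) := by
            rw [hMn]; ring
        _ = _ := by rw [hd.coupling_mul_eq hn]; ring
    have h6 := lt_of_mul_lt_mul_left h5 (by positivity)
    have h7 : 2 * R * (C + ∑' l, β l) * gammaSeq p τ δ Δ (level n) =
        (2 * R * (C + ∑' l, β l) * √(gammaSeq p τ δ Δ (level n))) *
          √(gammaSeq p τ δ Δ (level n)) := by
      rw [mul_assoc _ (√_), Real.mul_self_sqrt hγ.le]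
    rw [h7] at h6
    exact absurd h6 (not_lt.2 (mul_le_of_le_one_left (Real.sqrt_nonneg _) hC))
  · intro i _
    calc _ ≤ ((Finset.range (J + 1)).filter fun j =>
          (i + j) % d.blockLen n ∈ lowPositions (δ (level n)) (Δ (level n))).card :=
          Finset.card_le_card (Finset.filter_subset_filter _ hF)
      _ ≤ _ := card_filter_add_mod_mem_le (d.blockLen_pos n) _ _ _
      _ ≤ _ := by
          rw [hL]
          exact Nat.mul_le_mul_right _ (card_lowPositions_le _ _)

end IsCPlus2Type

end CTypeData

namespace CTypeData

namespace IsCPlus2Type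

variable {d : CTypeData} {p : ℝ≥0∞} {τ : ℕ → ℤ} {δ Δ : ℕ → ℕ}

/-- The thresholds for the leaks of the blocks are summable, by Cauchy condensation: there are
`2 ^ (k - 1)` blocks of level `k`. -/
theorem summable_sqrt_gammaSeq_level (hanti : AntitoneOn (gammaSeq p τ δ Δ) (Set.Ici 1))
    (hsum : Summable fun k : ℕ => (2 : ℝ) ^ (k + 1) * √(gammaSeq p τ δ Δ (k + 1))) :
    Summable fun n => if n = 0 then 0 else √(gammaSeq p τ δ Δ (level n)) := by
  refine (summable_condensed_iff_of_nonneg (fun n => ?_) fun m n hm hmn => ?_).1 ?_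
  · split_ifs
    · exact le_rfl
    · exact Real.sqrt_nonneg _
  · rw [if_neg (by omega), if_neg (by omega)]
    exact Real.sqrt_le_sqrt (hanti (one_le_level m) (one_le_level n)
      (Nat.succ_le_succ (Nat.log_mono_right hmn)))
  · refine (hsum.mul_left (1 / 2)).congr fun k => ?_
    have h : level (2 ^ k) = k + 1 := by rw [level, Nat.log_pow one_lt_two]
    rw [if_neg (pow_ne_zero _ two_ne_zero), h, pow_succ]
    ring

theorem tendsto_sqrt_gammaSeq
    (hsum : Summable fun k : ℕ => (2 : ℝ) ^ (k + 1) * √(gammaSeq p τ δ Δ (k + 1))) :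
    Tendsto (fun k => √(gammaSeq p τ δ Δ k)) atTop (𝓝 0) := by
  refine (tendsto_add_atTop_iff_nat 1).1 ?_
  refine squeeze_zero (fun _ => Real.sqrt_nonneg _) (fun k => ?_) hsum.tendsto_atTop_zero
  exact le_mul_of_one_le_left (Real.sqrt_nonneg _) (one_le_pow₀ one_le_two)

variable [Fact (1 ≤ p)] {T : lp (fun _ : ℕ => ℂ) p →L[ℂ] lp (fun _ : ℕ => ℂ) p}

/-- The number of visits of the orbit of a small vector to a suitable open set `V`, up to the time
`J`, when `J` is less than the parameters `δ` of the levels beyond `k`. -/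
theorem card_visits_le (hd : d.IsCPlus2Type τ δ Δ) (hT : d.IsOperator p T) (hp : p ≠ ∞)
    {R : ℝ} (hR : 0 ≤ R) {M : ℕ → ℝ}
    (hM : ∀ n j, ‖(T ^ j) (lp.single p (d.b (d.φ n)) 1)‖ ≤ M n)
    (hMn : ∀ n, 1 ≤ n → M n = R * (2 : ℝ) ^ (δ (level n - 1) : ℤ)) {β : ℕ → ℝ} (hβ00 : β 0 = 0)
    (hβ : Summable β) (hβn : ∀ n, 1 ≤ n → β n = √(gammaSeq p τ δ Δ (level n))) {C : ℝ}
    {k₀ : ℕ} (hC : ∀ k, k₀ ≤ k → 2 * R * (C + ∑' l, β l) * √(gammaSeq p τ δ Δ k) ≤ 1)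
    (hRγ : ∀ k, k₀ ≤ k → R * √(gammaSeq p τ δ Δ k) ≤ 1) {η : ℝ}
    (hη : ∀ k, k₀ ≤ k → (δ k : ℝ) ≤ η * Δ k)
    {x : lp (fun _ : ℕ => ℂ) p} (hx1 : ‖x‖ ≤ 1) (hx0 : ∀ j, ‖(T ^ j) (d.blockPart 0 x)‖ ≤ 1)
    (hxlow : ∀ n J, 1 ≤ n → level n < k₀ → ‖d.coupling n‖ * M n * d.leakedMass n x J ≤ β n)
    {k J : ℕ} (hk : k₀ ≤ k) (hJ : J < δ (k + 1)) (F : Finset ℕ) (hF : F ⊆ Finset.range (J + 1))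
    (hFC : ∀ j ∈ F, ‖(T ^ j) x‖ ≤ C ∧ 1 + ∑' l, β l < ‖(T ^ j) x 0‖) :
    (F.card : ℝ) ≤ 6 * η * J + 12 * δ k := by
  classical
  have hβ0 : ∀ n, 0 ≤ β n := by
    intro n
    rcases Nat.eq_zero_or_pos n with rfl | hn
    · exact hβ00.ge
    · rw [hβn n hn]; exact Real.sqrt_nonneg _
  have hη0 : 0 ≤ η := by
    have h4 := hd.four_mul_lt (k + 1) (by omega)
    have h5 := hη (k + 1) (by omega)
    by_contra h
    have : η * Δ (k + 1) < 0 := mul_neg_of_neg_of_pos (not_le.1 h) (by exact_mod_cast (by omega))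
    linarith [(δ (k + 1)).cast_nonneg (α := ℝ)]
  have hzero : ∀ J, ‖d.coupling 0‖ * M 0 * d.leakedMass 0 x J ≤ β 0 := by
    intro J; rw [coupling, if_pos rfl, hβ00]; simp
  have hhigh : ∀ n, 1 ≤ n → k < level n → ‖d.coupling n‖ * M n * d.leakedMass n x J ≤ β n := by
    intro n hn hkn
    have hγ := hd.gammaSeq_pos (p := p) (one_le_level n)
    rw [hMn n hn, hβn n hn]
    refine (hd.coupling_mul_leakedMass_le hp hn hR x
      (hJ.le.trans (hd.δ_mono (by omega) hkn))).trans ?_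
    calc R * gammaSeq p τ δ Δ (level n) * ‖x‖ ≤ R * gammaSeq p τ δ Δ (level n) :=
          mul_le_of_le_one_right (by positivity) hx1
      _ = (R * √(gammaSeq p τ δ Δ (level n))) * √(gammaSeq p τ δ Δ (level n)) := by
          rw [mul_assoc, Real.mul_self_sqrt hγ.le]
      _ ≤ _ := mul_le_of_le_one_left (Real.sqrt_nonneg _) (hRγ _ (by omega))
  -- the blocks with a significant leak up to time `J`; if there is none, then the coordinate
  -- number `0` remains small, and otherwise the last of them makes the orbit large
  set E := (Finset.range (2 ^ k)).filter fun n =>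
    β n < ‖d.coupling n‖ * M n * d.leakedMass n x J with hE
  have hout : ∀ n, n ∉ E → ‖d.coupling n‖ * M n * d.leakedMass n x J ≤ β n := by
    intro n hn
    rcases Nat.lt_or_ge n (2 ^ k) with h | h
    · by_contra hcon
      exact hn (Finset.mem_filter.2 ⟨Finset.mem_range.2 h, not_le.1 hcon⟩)
    · have hpos : 1 ≤ n := Nat.one_le_two_pow.trans h
      refine hhigh n hpos ?_
      by_contra hcon
      have := (lt_two_pow_level n).trans_le (Nat.pow_le_pow_right two_pos (not_lt.1 hcon))
      omega
  rcases E.eq_empty_or_nonempty with hE0 | hEne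
  · have : F = ∅ := by
      refine Finset.eq_empty_of_forall_notMem fun j hj => ?_
      obtain ⟨w, hw, hTw⟩ := hT.exists_pow_apply_eq_add hp hM hβ0 hβ x 0 (j := j) (J := J)
        (by have := Finset.mem_range.1 (hF hj); omega)
        (fun l _ => hout l (by rw [hE0]; exact Finset.notMem_empty l))
      have h1 := hTw 0 d.b_zero.le (by rw [b_succ]; have := d.blockLen_pos 0; omega)
      have h2 := (hFC j hj).2
      have hp0 : p ≠ 0 := (zero_lt_one.trans_le Fact.out).ne'
      have h3 := lp.norm_apply_le_norm hp0 ((T ^ j) (d.blockPart 0 x)) 0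
      have h4 := lp.norm_apply_le_norm hp0 w 0
      rw [h1] at h2
      have h5 := norm_add_le ((T ^ j) (d.blockPart 0 x) 0) (w 0)
      linarith [hx0 j]
    rw [this, Finset.card_empty, Nat.cast_zero]
    positivity
  · have hmem := Finset.mem_filter.1 (E.max'_mem hEne)
    set n := E.max' hEne with hn
    have hn1 : 1 ≤ n := by
      by_contra h
      have h0 : n = 0 := by omega
      rw [h0] at hmem
      exact absurd hmem.2 (not_lt.2 (hzero J))
    have hlk0 : k₀ ≤ level n := by
      by_contra h
      exact absurd hmem.2 (not_lt.2 (hxlow n J hn1 (by omega)))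
    have hlk : level n ≤ k := by
      by_contra h
      exact absurd hmem.2 (not_lt.2 (hhigh n hn1 (by omega)))
    have hno : ∀ l, n < l → ‖d.coupling l‖ * M l * d.leakedMass l x J ≤ β l := fun l hl =>
      hout l fun hlE => absurd (E.le_max' l hlE) (not_le.2 hl)
    refine (hd.card_le_of_leak hT hp hn1 hR hM (hMn n hn1) hβ0 hβ (hβn n hn1) (hC _ hlk0) x hno
      hmem.2 F hF fun j hj => (hFC j hj).1).trans ?_
    have h4 := hd.four_mul_lt_level n
    have hΔ : (0 : ℝ) < Δ (level n) := by exact_mod_cast (by omega : 0 < Δ (level n))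
    have h5 : ((J / Δ (level n) : ℕ) : ℝ) ≤ J / Δ (level n) := Nat.cast_div_le
    have h6 : (δ (level n) : ℝ) * (J / Δ (level n)) ≤ η * J := by
      rw [mul_div_assoc', div_le_iff₀ hΔ]
      have := hη _ hlk0
      nlinarith [J.cast_nonneg (α := ℝ)]
    have h7 : (δ (level n) : ℝ) ≤ δ k := by exact_mod_cast hd.δ_mono (one_le_level n) hlk
    have h8 : (δ (level n) : ℝ) * ((J / Δ (level n) : ℕ) : ℝ) ≤ δ (level n) * (J / Δ (level n)) :=
      mul_le_mul_of_nonneg_left h5 (Nat.cast_nonneg _)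
    push_cast
    nlinarith

/-- `T` is not frequently hypercyclic: the visits of any orbit to a suitable open set have lower
density zero, as is seen at the times `K * δ k` for a large constant `K`. -/
theorem not_isFrequentlyHypercyclic (hd : d.IsCPlus2Type τ δ Δ) (hT : d.IsOperator p T)
    (hp : p ≠ ∞) (hγ : ∀ k, 1 ≤ k → (2 : ℝ) ^ ((δ (k - 1) : ℤ) - τ k) ≤ 1 / 2)
    (hanti : AntitoneOn (gammaSeq p τ δ Δ) (Set.Ici 1))
    (hsum : Summable fun k : ℕ => (2 : ℝ) ^ (k + 1) * √(gammaSeq p τ δ Δ (k + 1)))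
    (hδδ : Tendsto (fun k : ℕ => (δ k : ℝ) / (δ (k + 1) : ℝ)) atTop (𝓝 0))
    (hδΔ : Tendsto (fun k : ℕ => (δ k : ℝ) / (Δ k : ℝ)) atTop (𝓝 0)) :
    ¬ IsFrequentlyHypercyclic T := by
  rintro ⟨x₀, hx₀⟩
  obtain ⟨R, hR1, hR⟩ := hd.exists_norm_pow_apply_le hT hγ
  have hR0 : 0 ≤ R := by linarith
  obtain ⟨M₀, hM₀⟩ := _root_.exists_norm_pow_apply_le
    (by have := d.blockLen_pos 0; omega : 0 < 2 * d.blockLen 0) (hT.pow_two_mul_len_apply_start 0)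
  set M : ℕ → ℝ := fun n => if n = 0 then M₀ else R * (2 : ℝ) ^ (δ (level n - 1) : ℤ) with hMdef
  have hMn : ∀ n, 1 ≤ n → M n = R * (2 : ℝ) ^ (δ (level n - 1) : ℤ) := fun n hn =>
    if_neg (by omega)
  have hM : ∀ n j, ‖(T ^ j) (lp.single p (d.b (d.φ n)) 1)‖ ≤ M n := by
    intro n j
    rcases Nat.eq_zero_or_pos n with rfl | hn
    · rw [d.φ_zero]; exact hM₀ j
    · rw [hMn n hn]; exact hR n hn j
  set β : ℕ → ℝ := fun n => if n = 0 then 0 else √(gammaSeq p τ δ Δ (level n)) with hβdef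
  have hβn : ∀ n, 1 ≤ n → β n = √(gammaSeq p τ δ Δ (level n)) := fun n hn => if_neg (by omega)
  have hβ : Summable β := summable_sqrt_gammaSeq_level hanti hsum
  have hβpos : ∀ n, 1 ≤ n → 0 < β n := fun n hn => by
    rw [hβn n hn]; exact Real.sqrt_pos.2 (hd.gammaSeq_pos (one_le_level n))
  set B := ∑' l, β l with hB
  have hB0 : 0 ≤ B := tsum_nonneg fun n => by
    rcases Nat.eq_zero_or_pos n with rfl | hn
    · exact le_rfl
    · exact (hβpos n hn).le
  have hp0 : p ≠ 0 := (zero_lt_one.trans_le Fact.out).ne'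
  -- an open set of vectors of moderate norm with a large coordinate number `0`
  set V : Set (lp (fun _ : ℕ => ℂ) p) := {y | ‖y‖ < B + 3 ∧ 1 + B < ‖y 0‖} with hV
  have hVo : IsOpen V := (isOpen_lt continuous_norm continuous_const).inter
    (isOpen_lt continuous_const (lp.evalCLM ℂ (fun _ : ℕ => ℂ) p 0).continuous.norm)
  have hVne : V.Nonempty := by
    refine ⟨((B + 2 : ℝ) : ℂ) • lp.single p 0 1, ?_, ?_⟩
    · rw [norm_smul, norm_single_one, mul_one, Complex.norm_real, Real.norm_of_nonneg (by linarith)]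
      linarith
    · rw [lp.coeFn_smul, Pi.smul_apply, single_one_apply, if_pos rfl, norm_smul, norm_one, mul_one,
        Complex.norm_real, Real.norm_of_nonneg (by linarith)]
      linarith
  obtain ⟨c, hc, hcount⟩ := exists_eventually_of_lowerDensity_pos (hx₀ V hVo hVne)
  have hsq := tendsto_sqrt_gammaSeq hsum
  have ev1 : ∀ᶠ k in atTop, 2 * R * (B + 3 + B) * √(gammaSeq p τ δ Δ k) ≤ 1 := by
    have := hsq.const_mul (2 * R * (B + 3 + B))
    rw [mul_zero] at this
    exact this.eventually_le_const one_pos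
  have ev2 : ∀ᶠ k in atTop, R * √(gammaSeq p τ δ Δ k) ≤ 1 := by
    have := hsq.const_mul R
    rw [mul_zero] at this
    exact this.eventually_le_const one_pos
  have ev3 : ∀ᶠ k in atTop, (δ k : ℝ) ≤ c / 24 * Δ k := by
    filter_upwards [hδΔ.eventually_le_const (by positivity : (0 : ℝ) < c / 24),
      eventually_ge_atTop 1] with k hk hk1
    rwa [div_le_iff₀ (by exact_mod_cast (Nat.zero_le _).trans_lt (hd.four_mul_lt k hk1))] at hk
  obtain ⟨k₀, hk₀⟩ := eventually_atTop.1 (ev1.and (ev2.and ev3))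
  -- the orbit of `x₀` meets each neighbourhood of `0`; its starting point is moved there
  have hsmall : ∀ᶠ x in 𝓝 (0 : lp (fun _ : ℕ => ℂ) p), ‖x‖ ≤ 1 ∧
      (M₀ * ∑ i ∈ Finset.range (d.blockLen 0), d.mass 0 x i ≤ 1) ∧
      ∀ n ∈ Finset.range (2 ^ k₀), 1 ≤ n → ‖d.coupling n‖ * M n *
        ∑ i ∈ Finset.range (d.blockLen n), d.mass n x i ≤ β n := by
    refine Eventually.and ?_ (Eventually.and ?_ ((Finset.eventually_all _).2 fun n _ => ?_))
    · have : Tendsto (fun x : lp (fun _ : ℕ => ℂ) p => ‖x‖) (𝓝 0) (𝓝 0) := by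
        simpa using (continuous_norm (E := lp (fun _ : ℕ => ℂ) p)).tendsto 0
      exact this.eventually_le_const one_pos
    · have := (d.tendsto_sum_mass (p := p) 0).const_mul M₀
      rw [mul_zero] at this
      exact this.eventually_le_const one_pos
    · rcases Nat.eq_zero_or_pos n with rfl | hn
      · exact Eventually.of_forall fun x h => absurd h (by omega)
      · have := (d.tendsto_sum_mass (p := p) n).const_mul (‖d.coupling n‖ * M n)
        rw [mul_zero] at this
        exact (this.eventually_le_const (hβpos n hn)).mono fun x hx _ => hx
  obtain ⟨U, hUsub, hUo, hU0⟩ := mem_nhds_iff.1 hsmall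
  obtain ⟨i₀, hi₀⟩ := lowerDensity_pos_nonempty (hx₀ U hUo ⟨0, hU0⟩)
  rw [visitTimes, Set.mem_ofPred_eq, iterate_eq_pow] at hi₀
  set x := (T ^ i₀) x₀ with hx
  obtain ⟨hx1, hx2, hx3⟩ := hUsub hi₀
  have hM0nonneg : 0 ≤ M₀ := (norm_nonneg _).trans (hM₀ 0)
  have hxlow : ∀ n J, 1 ≤ n → level n < k₀ →
      ‖d.coupling n‖ * M n * d.leakedMass n x J ≤ β n := by
    intro n J hn hlev
    have hMn0 : 0 ≤ M n := (norm_nonneg _).trans (hM n 0)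
    refine le_trans ?_ (hx3 n (Finset.mem_range.2 ((lt_two_pow_level n).trans_le
      (Nat.pow_le_pow_right two_pos hlev.le))) hn)
    gcongr
    exact d.leakedMass_le n x J
  -- the times `J = K * δ k` contradict the lower density of the visits to `V`
  obtain ⟨K, hK⟩ := exists_nat_ge (48 / c)
  have hKpos : 0 < K := by
    have : (0 : ℝ) < K := lt_of_lt_of_le (by positivity) hK
    exact_mod_cast this
  have hJtend : Tendsto (fun k => K * δ k) atTop atTop :=
    tendsto_atTop_mono (fun k => Nat.le_mul_of_pos_left _ hKpos) hd.tendsto_δ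
  have ev4 : ∀ᶠ k in atTop, K * δ k < δ (k + 1) := by
    filter_upwards [hδδ.eventually_lt_const (by positivity : (0 : ℝ) < 1 / K),
      hd.tendsto_δ.eventually_gt_atTop 0, eventually_ge_atTop 1] with k hk hk0 hk1
    have h1 : 0 < δ (k + 1) := hk0.trans_le (hd.δ_mono hk1 (Nat.le_succ k))
    rw [div_lt_div_iff₀ (by exact_mod_cast h1) (by exact_mod_cast hKpos), one_mul] at hk
    rw [mul_comm]
    exact_mod_cast hk
  have ev5 : ∀ᶠ k in atTop, c * (((K * δ k + i₀ : ℕ) : ℝ) + 1) ≤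
      ((visitTimes (⇑T) x₀ V ∩ Set.Iic (K * δ k + i₀)).ncard : ℝ) :=
    (tendsto_atTop_mono (fun k => Nat.le_add_right _ i₀) hJtend).eventually hcount
  have ev6 : ∀ᶠ k in atTop, (2 * i₀ / c : ℝ) ≤ ((K * δ k : ℕ) : ℝ) :=
    (tendsto_natCast_atTop_atTop.comp hJtend).eventually_ge_atTop _
  obtain ⟨k, h4, h5, h6, hk⟩ := (ev4.and (ev5.and (ev6.and (eventually_ge_atTop k₀)))).exists
  classical
  set J := K * δ k with hJ
  set F := (Finset.range (J + 1)).filter fun j => (T ^ j) x ∈ V with hF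
  have hcard := hd.card_visits_le hT hp hR0 hM hMn (if_pos rfl) hβ hβn (C := B + 3)
    (fun k hk => (hk₀ k hk).1) (fun k hk => (hk₀ k hk).2.1) (fun k hk => (hk₀ k hk).2.2) hx1
    (fun j => (hT.norm_pow_apply_blockPart_le 0 hM₀ x j).trans hx2) hxlow hk h4 F
    (Finset.filter_subset _ _) (fun j hj => by
      obtain ⟨h1, h2⟩ := (Finset.mem_filter.1 hj).2
      exact ⟨h1.le, h2⟩)
  have hsub : visitTimes (⇑T) x₀ V ∩ Set.Iic (J + i₀) ⊆
      ((Finset.range i₀ ∪ F.image fun j => j + i₀ : Finset ℕ) : Set ℕ) := by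
    rintro i ⟨hi, hiJ⟩
    rw [visitTimes, Set.mem_ofPred_eq, iterate_eq_pow] at hi
    rw [Set.mem_Iic] at hiJ
    rw [Finset.mem_coe, Finset.mem_union, Finset.mem_range, Finset.mem_image]
    rcases Nat.lt_or_ge i i₀ with h | h
    · exact Or.inl h
    · obtain ⟨j, rfl⟩ := Nat.exists_eq_add_of_le' h
      refine Or.inr ⟨j, Finset.mem_filter.2 ⟨Finset.mem_range.2 (by omega), ?_⟩, rfl⟩
      rwa [hx, ← mul_apply_eq_comp, ← pow_add]
  have hn1 := Set.ncard_le_ncard hsub (Finset.finite_toSet _)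
  rw [Set.ncard_coe_finset] at hn1
  have hn2 := hn1.trans ((Finset.card_union_le _ _).trans
    (Nat.add_le_add (Finset.card_range i₀).le Finset.card_image_le))
  have hn3 : ((visitTimes (⇑T) x₀ V ∩ Set.Iic (J + i₀)).ncard : ℝ) ≤ i₀ + F.card := by
    exact_mod_cast hn2
  rw [div_le_iff₀ hc] at h6 hK
  have h7 : 12 * (δ k : ℝ) ≤ c / 4 * J := by
    rw [hJ]; push_cast
    nlinarith [(δ k).cast_nonneg (α := ℝ)]
  have h8 : c * (J : ℝ) ≤ i₀ + (6 * (c / 24) * J + c / 4 * J) := by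
    push_cast at h5
    have : 0 ≤ c * (i₀ : ℝ) := by positivity
    nlinarith
  push_cast at h5
  have : 0 ≤ c * (i₀ : ℝ) := by positivity
  nlinarith

end IsCPlus2Type

end CTypeData

namespace CTypeData

/-! ### The theorem for given parameters -/

theorem IsCPlus2Type.dynamics {d : CTypeData} {p : ℝ≥0∞} {τ : ℕ → ℤ} {δ Δ : ℕ → ℕ}
    [Fact (1 ≤ p)] (hp : p ≠ ∞) (hd : d.IsCPlus2Type τ δ Δ)
    (hanti : AntitoneOn (gammaSeq p τ δ Δ) (Set.Ici 1))
    (hsum : Summable fun k : ℕ => (2 : ℝ) ^ (k + 1) * √(gammaSeq p τ δ Δ (k + 1)))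
    (hle : ∑' k : ℕ, (2 : ℝ) ^ (k + 1) * √(gammaSeq p τ δ Δ (k + 1)) ≤ 1)
    (hτδ : limsup (fun k : ℕ => (((τ k : ℝ) / (δ k : ℝ) : ℝ) : EReal)) atTop < 1)
    (hδδ : Tendsto (fun k : ℕ => (δ k : ℝ) / (δ (k + 1) : ℝ)) atTop (𝓝 0))
    (hδΔ : Tendsto (fun k : ℕ => (δ k : ℝ) / (Δ k : ℝ)) atTop (𝓝 0))
    (T : lp (fun _ : ℕ => ℂ) p →L[ℂ] lp (fun _ : ℕ => ℂ) p) (hT : d.IsOperator p T) :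
    IsChaotic T ∧ IsUFrequentlyHypercyclic T ∧ ¬ IsFrequentlyHypercyclic T := by
  have hγ : ∀ k, 1 ≤ k → (2 : ℝ) ^ ((δ (k - 1) : ℤ) - τ k) ≤ 1 / 2 := by
    intro k hk
    have h1 : (2 : ℝ) ^ k * √(gammaSeq p τ δ Δ k) ≤ 1 := by
      have := (hsum.le_tsum (k - 1) fun j _ => by positivity).trans hle
      rwa [Nat.sub_add_cancel hk] at this
    have h2 : (2 : ℝ) ≤ 2 ^ k := by
      simpa using pow_le_pow_right₀ (one_le_two (α := ℝ)) hk
    have h3 := hd.gammaSeq_pos (p := p) hk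
    have h4 : √(gammaSeq p τ δ Δ k) ≤ 1 / 2 := by nlinarith [Real.sqrt_nonneg (gammaSeq p τ δ Δ k)]
    have h5 : gammaSeq p τ δ Δ k ≤ 1 / 2 := by
      nlinarith [Real.mul_self_sqrt h3.le, Real.sqrt_nonneg (gammaSeq p τ δ Δ k)]
    refine le_trans ?_ h5
    have h6 : (1 : ℝ) ≤ Δ k := by
      exact_mod_cast (by have := hd.four_mul_lt k hk; omega : 1 ≤ Δ k)
    have h7 : 1 / p.toReal ≤ 1 := by
      rw [div_le_one (toReal_pos_of_fact hp)]
      exact one_le_toReal_of_fact hp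
    exact le_mul_of_one_le_right (by positivity) (Real.one_le_rpow h6 (by linarith))
  obtain ⟨q, hq1, hq2⟩ := EReal.lt_iff_exists_real_btwn.1 hτδ
  have hq : q < 1 := by exact_mod_cast hq2
  have hτ : ∀ᶠ k in atTop, (τ k : ℝ) ≤ (1 - min (1 - q) 1) * δ k := by
    filter_upwards [eventually_lt_of_limsup_lt hq1, hd.tendsto_δ.eventually_gt_atTop 0]
      with k hk hδ
    have h1 : (τ k : ℝ) / δ k < q := by exact_mod_cast hk
    have h2 : (0 : ℝ) < δ k := by exact_mod_cast hδ
    rw [div_lt_iff₀ h2] at h1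
    have := min_le_left (1 - q) 1
    nlinarith
  have hη : 0 < min (1 - q) 1 := lt_min (by linarith) one_pos
  exact ⟨hd.isChaotic hp hT hη (min_le_right _ _) hτ,
    hd.isUFrequentlyHypercyclic hp hT hη (min_le_right _ _) hτ,
    hd.not_isFrequentlyHypercyclic hT hp hγ hanti hsum hδδ hδΔ⟩

/-! ### Existence of parameters -/

theorem norm_cPlus2Weight_mem (s D i : ℕ) :
    1 / 2 ≤ ‖cPlus2Weight s D i‖ ∧ ‖cPlus2Weight s D i‖ ≤ 2 := by
  rw [cPlus2Weight]
  split_ifs <;> norm_num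

/-- Sufficient conditions for the existence of parameters of C₊,₂-type. The block number `0`, on
which there is no condition, is taken of length `1`. -/
theorem exists_isCPlus2Type {τ : ℕ → ℤ} {δ Δ : ℕ → ℕ} (hτ : StrictMonoOn τ (Set.Ici 1))
    (hτ2 : ∀ k : ℕ, 1 ≤ k → 2 * (k : ℤ) ≤ τ k) (hδ : StrictMonoOn δ (Set.Ici 1))
    (h4 : ∀ k, 1 ≤ k → 4 * δ k < Δ k) (hΔ2 : ∀ k, 1 ≤ k → 2 ∣ Δ k)
    (hΔ : ∀ j k, 1 ≤ j → j < k → 2 * Δ j ∣ Δ k) :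
    ∃ d : CTypeData, d.IsCPlus2Type τ δ Δ := by
  classical
  set len : ℕ → ℕ := fun n => if n = 0 then 1 else Δ (level n) with hlen
  have hlen0 : len 0 = 1 := if_pos rfl
  have hlen1 : ∀ n, 1 ≤ n → len n = Δ (level n) := fun n hn => if_neg (by omega)
  have hlenpos : ∀ n, 0 < len n := by
    intro n
    rcases Nat.eq_zero_or_pos n with rfl | hn
    · rw [hlen0]; exact one_pos
    · rw [hlen1 n hn]; exact (Nat.zero_le _).trans_lt (h4 _ (one_le_level n))
  set b : ℕ → ℕ := fun n => ∑ i ∈ Finset.range n, len i with hb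
  have hbs : ∀ n, b (n + 1) = b n + len n := fun n => Finset.sum_range_succ _ _
  have hbm : StrictMono b := strictMono_nat_of_lt_succ fun n => by
    rw [hbs]; exact Nat.lt_add_of_pos_right (hlenpos n)
  have huniq : ∀ n n' i i', i < len n → i' < len n' → b n + i = b n' + i' → n = n' := by
    intro n n' i i' hi hi' h
    have key : ∀ m m' j j', j < len m → m < m' → b m + j < b m' + j' := by
      intro m m' j j' hj hm
      have := hbm.monotone (Nat.succ_le_of_lt hm)
      rw [Nat.succ_eq_add_one, hbs] at this
      omega
    rcases Nat.lt_trichotomy n n' with hlt | heq | hlt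
    · exact absurd h (key _ _ _ _ hi hlt).ne
    · exact heq
    · exact absurd h (key _ _ _ _ hi' hlt).ne'
  set w : ℕ → ℂ := fun j =>
    if h : ∃ n, 1 ≤ n ∧ b n ≤ j ∧ j < b (n + 1) then
      cPlus2Weight (δ (level h.choose)) (Δ (level h.choose)) (j - b h.choose) else 1 with hw
  have hweq : ∀ n i, 1 ≤ n → i < len n → w (b n + i) =
      cPlus2Weight (δ (level n)) (Δ (level n)) i := by
    intro n i hn hi
    have h : ∃ n', 1 ≤ n' ∧ b n' ≤ b n + i ∧ b n + i < b (n' + 1) :=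
      ⟨n, hn, Nat.le_add_right _ _, by rw [hbs]; omega⟩
    have h2 : h.choose = n := by
      obtain ⟨-, h3, h5⟩ := h.choose_spec
      rw [hbs] at h5
      exact huniq _ _ (b n + i - b h.choose) i (by omega) hi (by omega)
    simp only [hw]
    rw [dif_pos h, h2, Nat.add_sub_cancel_left]
  have hwb : ∀ j, 1 / 2 ≤ ‖w j‖ ∧ ‖w j‖ ≤ 2 := by
    intro j
    simp only [hw]
    split_ifs
    · exact norm_cPlus2Weight_mem _ _ _
    · norm_num
  have hφlt : ∀ n, 1 ≤ n → n - 2 ^ (level n - 1) < n := fun n hn =>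
    Nat.sub_lt hn (Nat.two_pow_pos _)
  let d : CTypeData :=
    { v := fun n => (2 : ℂ) ^ (-τ (level n))
      w := w
      φ := fun n => n - 2 ^ (level n - 1)
      b := b
      v_ne_zero := fun n _ => zpow_ne_zero _ two_ne_zero
      v_summable := by
        have h := (summable_nat_add_iff 1).2 (Real.summable_one_div_nat_pow.2 one_lt_two)
        refine Summable.of_nonneg_of_le (fun n => norm_nonneg _) (fun n => ?_) h
        have h1 := hτ2 _ (one_le_level (n + 1))
        have h2 : ((n + 1 : ℕ) : ℝ) ≤ 2 ^ level (n + 1) := by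
          exact_mod_cast (lt_two_pow_level (n + 1)).le
        rw [norm_zpow, Complex.norm_ofNat]
        calc (2 : ℝ) ^ (-τ (level (n + 1))) ≤ (2 : ℝ) ^ (-((level (n + 1) * 2 : ℕ) : ℤ)) :=
              zpow_le_zpow_right₀ one_le_two (by push_cast; linarith)
          _ = 1 / ((2 : ℝ) ^ level (n + 1)) ^ 2 := by
              rw [zpow_neg, zpow_natCast, one_div, pow_mul]
          _ ≤ 1 / ((n + 1 : ℕ) : ℝ) ^ 2 := by gcongr
      w_bounded := ⟨2, fun j _ => (hwb j).2⟩
      w_bounded_below := ⟨1 / 2, by norm_num, fun j _ => (hwb j).1⟩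
      φ_zero := Nat.zero_sub _
      φ_lt := hφlt
      φ_fiber_infinite := fun l => by
        refine Set.infinite_of_injective_forall_mem (f := fun k => 2 ^ (k + l) + l) ?_ ?_
        · intro k k' h
          have h1 : 2 ^ (k + l) = 2 ^ (k' + l) := by simpa using h
          have := Nat.pow_right_injective le_rfl h1
          omega
        · intro k
          have h1 : l < 2 ^ (k + l) :=
            Nat.lt_two_pow_self.trans_le (Nat.pow_le_pow_right two_pos (by omega))
          have h2 : level (2 ^ (k + l) + l) = k + l + 1 :=
            level_eq (by omega) (by simp) (by rw [pow_succ]; omega)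
          rw [Set.mem_ofPred_eq, h2, Nat.add_sub_cancel, Nat.add_sub_cancel_left]
      b_zero := rfl
      b_strictMono := hbm
      b_dvd := fun n hn => by
        simp only [hbs, Nat.add_sub_cancel_left]
        rw [hlen1 n hn]
        rcases Nat.eq_zero_or_pos (n - 2 ^ (level n - 1)) with h | h
        · rw [h, hlen0]; exact hΔ2 _ (one_le_level n)
        · rw [hlen1 _ h]
          have := level_sub_le h
          have := one_le_level n
          exact hΔ _ _ (one_le_level _) (by omega)
      prod_bounded_below := by
        refine ⟨1, one_pos, fun n => ?_⟩
        have h : Finset.Ioo (b n) (b (n + 1)) = Finset.Ico (b n + 1) (b (n + 1)) := by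
          ext j; simp only [Finset.mem_Ioo, Finset.mem_Ico]; omega
        have h2 : b (n + 1) - (b n + 1) = len n - 1 := by rw [hbs]; omega
        rw [h, Finset.prod_Ico_eq_prod_range, h2]
        rcases Nat.eq_zero_or_pos n with rfl | hn
        · rw [hlen0, Nat.sub_self, Finset.range_zero, Finset.prod_empty]
        · have h5 := h4 _ (one_le_level n)
          have h6 : ∀ j ∈ Finset.range (len n - 1), ‖w (b n + 1 + j)‖ =
              ‖cPlus2Weight (δ (level n)) (Δ (level n)) (j + 1)‖ := by
            intro j hj
            have := Finset.mem_range.1 hj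
            rw [add_assoc, add_comm 1 j, hweq n (j + 1) hn (by omega)]
          rw [Finset.prod_congr rfl h6, hlen1 n hn, prod_norm_cPlus2Weight h5 (by omega)]
          refine one_le_zpow₀ one_le_two ?_
          simp only [height]; omega }
  refine ⟨d, ⟨⟨?_, ?_, ?_, ?_⟩, hτ, hδ, h4⟩⟩
  · intro k hk n h1 h2
    change n - 2 ^ (level n - 1) = _
    rw [level_eq hk h1 h2]
  · intro k hk n h1 h2
    change b (n + 1) - b n = _
    rw [hbs, Nat.add_sub_cancel_left, hlen1 n (Nat.one_le_two_pow.trans h1), level_eq hk h1 h2]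
  · intro k hk n h1 h2
    change (2 : ℂ) ^ (-τ (level n)) = _
    rw [level_eq hk h1 h2]
  · intro k hk n h1 h2 i _ hi
    have hn : 1 ≤ n := Nat.one_le_two_pow.trans h1
    have hlev := level_eq hk h1 h2
    change w (b n + i) = _
    rw [hweq n i hn (by rwa [hlen1 n hn, hlev]), hlev]

/-! ### Doubly exponential parameters -/

theorem three_mul_add_four_le_two_pow {m : ℕ} (hm : 6 ≤ m) : 3 * m + 4 ≤ 2 ^ (m - 1) := by
  obtain ⟨t, rfl⟩ := Nat.exists_eq_add_of_le' hm
  have h1 : t < 2 ^ t := Nat.lt_two_pow_self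
  have h2 : t + 6 - 1 = t + 5 := by omega
  rw [h2, pow_add]
  omega

/-- The exponent inequality behind `γ k ≤ 2 ^ (-4 k)`. -/
theorem exponent_le {C k : ℕ} (hC : 6 ≤ C) (hk : 1 ≤ k) :
    2 ^ (C * (k - 1) ^ 2 + 1) + (2 * C * k ^ 2 + 4) + 4 * k ≤ 2 ^ (C * k ^ 2) := by
  obtain ⟨j, rfl⟩ := Nat.exists_eq_add_of_le' hk
  rw [Nat.add_sub_cancel]
  have hm : 6 * (j + 1) ≤ C * (j + 1) ^ 2 := by nlinarith
  have h1 : C * j ^ 2 + 1 ≤ C * (j + 1) ^ 2 - 1 := by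
    have : C * (j + 1) ^ 2 = C * j ^ 2 + C * (2 * j + 1) := by ring
    have : 6 ≤ C * (2 * j + 1) := by nlinarith
    omega
  have h2 := Nat.pow_le_pow_right two_pos h1
  have h3 := three_mul_add_four_le_two_pow (m := C * (j + 1) ^ 2) (by omega)
  have h4 : 2 ^ (C * (j + 1) ^ 2) = 2 ^ (C * (j + 1) ^ 2 - 1) * 2 := by
    rw [← pow_succ, Nat.sub_add_cancel (by omega)]
  have h5 : 2 * C * (j + 1) ^ 2 = 2 * (C * (j + 1) ^ 2) := by ring
  omega

/-- The exponent inequality behind `γ (k + 1) ≤ γ k`. -/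
theorem exponent_succ_le {C k : ℕ} (hC : 6 ≤ C) :
    2 ^ (C * k ^ 2 + 1) + 2 * C * (2 * k + 1) + 2 ^ (C * k ^ 2) ≤ 2 ^ (C * (k + 1) ^ 2) := by
  have e : C * (k + 1) ^ 2 = C * k ^ 2 + C * (2 * k + 1) := by ring
  have hs : 6 ≤ C * (2 * k + 1) := by nlinarith
  have h1 := three_mul_add_four_le_two_pow hs
  have h2 : 2 ^ (C * (2 * k + 1) - 1) ≤ 2 ^ (C * (2 * k + 1)) :=
    Nat.pow_le_pow_right two_pos (by omega)
  have h3 : 1 ≤ 2 ^ (C * k ^ 2) := Nat.one_le_two_pow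
  have e2 : 2 * C * (2 * k + 1) = 2 * (C * (2 * k + 1)) := by ring
  have h4 : 2 * (C * (2 * k + 1)) + 3 ≤ 2 ^ (C * (2 * k + 1)) := by omega
  rw [e, pow_succ 2 (C * k ^ 2), pow_add 2 (C * k ^ 2), e2]
  nlinarith [Nat.mul_le_mul_left (2 ^ (C * k ^ 2)) h4]

theorem two_pow_div_two_pow_le {a b k : ℕ} (h : a + k ≤ b) :
    (2 : ℝ) ^ a / 2 ^ b ≤ (1 / 2) ^ k := by
  rw [div_le_iff₀ (by positivity)]
  calc (2 : ℝ) ^ a = (1 / 2) ^ k * 2 ^ (a + k) := by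
        rw [pow_add, mul_comm ((2 : ℝ) ^ a), ← mul_assoc, ← mul_pow]; norm_num
    _ ≤ (1 / 2) ^ k * 2 ^ b := by
        gcongr
        exact one_le_two

theorem exists_isCPlus2Type_two_pow {C : ℕ} (hC : 6 ≤ C) :
    ∃ d : CTypeData, d.IsCPlus2Type (fun k => 2 ^ (C * k ^ 2))
      (fun k => 2 ^ (C * k ^ 2 + 1)) (fun k => 2 ^ (2 * C * k ^ 2 + 4)) := by
  have hlt : ∀ i j : ℕ, i < j → C * i ^ 2 < C * j ^ 2 := fun i j hij => by
    have : i ^ 2 < j ^ 2 := Nat.pow_lt_pow_left hij two_ne_zero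
    nlinarith
  refine exists_isCPlus2Type ?_ ?_ ?_ ?_ ?_ ?_
  · intro i _ j _ hij
    exact pow_lt_pow_right₀ (by norm_num) (hlt i j hij)
  · intro k hk
    have := exponent_le hC hk
    have h2 : 2 * k ≤ 2 ^ (C * k ^ 2) := by
      linarith [Nat.zero_le (2 ^ (C * (k - 1) ^ 2 + 1)), Nat.zero_le (2 * C * k ^ 2)]
    exact_mod_cast h2
  · intro i _ j _ hij
    exact Nat.pow_lt_pow_right one_lt_two (Nat.succ_lt_succ (hlt i j hij))
  · intro k hk
    have : 4 * 2 ^ (C * k ^ 2 + 1) = 2 ^ (C * k ^ 2 + 3) := by rw [pow_add, pow_add]; ring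
    rw [this]
    refine Nat.pow_lt_pow_right one_lt_two ?_
    nlinarith [Nat.zero_le (C * k ^ 2)]
  · intro k _
    exact dvd_pow_self 2 (by omega)
  · intro j k _ hjk
    have := hlt j k hjk
    rw [← pow_succ']
    refine pow_dvd_pow 2 ?_
    rw [mul_assoc, mul_assoc]
    omega

section TwoPow

variable {p : ℝ≥0∞} {C : ℕ}

theorem gammaSeq_two_pow_le (hC : 6 ≤ C) {k : ℕ} (hk : 1 ≤ k) :
    gammaSeq p (fun k => 2 ^ (C * k ^ 2)) (fun k => 2 ^ (C * k ^ 2 + 1))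
      (fun k => 2 ^ (2 * C * k ^ 2 + 4)) k ≤ ((1 / 4 : ℝ) ^ k) ^ 2 := by
  have hp1 : 0 ≤ 1 / p.toReal := one_div_nonneg.2 ENNReal.toReal_nonneg
  have h1 : (((2 ^ (2 * C * k ^ 2 + 4) : ℕ) : ℝ)) ^ (1 - 1 / p.toReal) ≤
      (2 : ℝ) ^ ((2 * C * k ^ 2 + 4 : ℕ) : ℤ) := by
    rw [zpow_natCast]
    push_cast
    refine (Real.rpow_le_rpow_of_exponent_le (one_le_pow₀ one_le_two)
      (by linarith : 1 - 1 / p.toReal ≤ 1)).trans ?_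
    rw [Real.rpow_one]
  have h2 : ((2 ^ (C * (k - 1) ^ 2 + 1) : ℕ) : ℤ) + ((2 * C * k ^ 2 + 4 : ℕ) : ℤ) + 4 * k ≤
      2 ^ (C * k ^ 2) := by exact_mod_cast exponent_le hC hk
  rw [gammaSeq]
  calc _ ≤ (2 : ℝ) ^ (((2 ^ (C * (k - 1) ^ 2 + 1) : ℕ) : ℤ) - 2 ^ (C * k ^ 2)) *
        (2 : ℝ) ^ ((2 * C * k ^ 2 + 4 : ℕ) : ℤ) := by gcongr
    _ = (2 : ℝ) ^ (((2 ^ (C * (k - 1) ^ 2 + 1) : ℕ) : ℤ) - 2 ^ (C * k ^ 2) +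
        ((2 * C * k ^ 2 + 4 : ℕ) : ℤ)) := (zpow_add₀ two_ne_zero _ _).symm
    _ ≤ (2 : ℝ) ^ (-((4 * k : ℕ) : ℤ)) := zpow_le_zpow_right₀ one_le_two (by push_cast at *; linarith)
    _ = ((1 / 4 : ℝ) ^ k) ^ 2 := by
        rw [zpow_neg, zpow_natCast, pow_mul, ← inv_pow, ← pow_mul, mul_comm k 2, pow_mul]
        norm_num

theorem antitoneOn_gammaSeq_two_pow (hC : 6 ≤ C) :
    AntitoneOn (gammaSeq p (fun k => 2 ^ (C * k ^ 2)) (fun k => 2 ^ (C * k ^ 2 + 1))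
      (fun k => 2 ^ (2 * C * k ^ 2 + 4))) (Set.Ici 1) := by
  have hp1 : 0 ≤ 1 / p.toReal := one_div_nonneg.2 ENNReal.toReal_nonneg
  refine antitoneOn_nat_Ici_of_succ_le fun k hk => ?_
  have e : (((2 ^ (2 * C * (k + 1) ^ 2 + 4) : ℕ) : ℝ)) =
      ((2 ^ (2 * C * k ^ 2 + 4) : ℕ) : ℝ) * (2 : ℝ) ^ (2 * C * (2 * k + 1)) := by
    push_cast
    rw [← pow_add]
    congr 1
    ring
  have h1 : ((2 : ℝ) ^ (2 * C * (2 * k + 1))) ^ (1 - 1 / p.toReal) ≤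
      (2 : ℝ) ^ ((2 * C * (2 * k + 1) : ℕ) : ℤ) := by
    rw [zpow_natCast]
    refine (Real.rpow_le_rpow_of_exponent_le (one_le_pow₀ one_le_two)
      (by linarith : 1 - 1 / p.toReal ≤ 1)).trans ?_
    rw [Real.rpow_one]
  have h2 : ((2 ^ (C * k ^ 2 + 1) : ℕ) : ℤ) + ((2 * C * (2 * k + 1) : ℕ) : ℤ) + 2 ^ (C * k ^ 2) ≤
      2 ^ (C * (k + 1) ^ 2) := by exact_mod_cast exponent_succ_le (k := k) hC
  have h3 : (0 : ℤ) ≤ ((2 ^ (C * (k - 1) ^ 2 + 1) : ℕ) : ℤ) := by positivity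
  simp only [gammaSeq, Nat.add_sub_cancel]
  rw [e, Real.mul_rpow (by positivity) (by positivity)]
  calc _ ≤ (2 : ℝ) ^ (((2 ^ (C * k ^ 2 + 1) : ℕ) : ℤ) - 2 ^ (C * (k + 1) ^ 2)) *
        (((2 ^ (2 * C * k ^ 2 + 4) : ℕ) : ℝ) ^ (1 - 1 / p.toReal) *
          (2 : ℝ) ^ ((2 * C * (2 * k + 1) : ℕ) : ℤ)) := by gcongr
    _ = (2 : ℝ) ^ (((2 ^ (C * k ^ 2 + 1) : ℕ) : ℤ) - 2 ^ (C * (k + 1) ^ 2) +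
          ((2 * C * (2 * k + 1) : ℕ) : ℤ)) *
        ((2 ^ (2 * C * k ^ 2 + 4) : ℕ) : ℝ) ^ (1 - 1 / p.toReal) := by
        rw [zpow_add₀ two_ne_zero]; ring
    _ ≤ _ := by
        gcongr
        · exact one_le_two
        · linarith

theorem IsCPlus2Type.dynamics_two_pow [Fact (1 ≤ p)] (hp : p ≠ ∞) (hC : 6 ≤ C) {d : CTypeData}
    (hd : d.IsCPlus2Type (fun k => 2 ^ (C * k ^ 2)) (fun k => 2 ^ (C * k ^ 2 + 1))
      (fun k => 2 ^ (2 * C * k ^ 2 + 4)))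
    (T : lp (fun _ : ℕ => ℂ) p →L[ℂ] lp (fun _ : ℕ => ℂ) p) (hT : d.IsOperator p T) :
    IsChaotic T ∧ IsUFrequentlyHypercyclic T ∧ ¬ IsFrequentlyHypercyclic T := by
  have hbound : ∀ k : ℕ, (2 : ℝ) ^ (k + 1) * √(gammaSeq p (fun k => 2 ^ (C * k ^ 2))
      (fun k => 2 ^ (C * k ^ 2 + 1)) (fun k => 2 ^ (2 * C * k ^ 2 + 4)) (k + 1)) ≤
      1 / 2 * (1 / 2) ^ k := by
    intro k
    have h := Real.sqrt_le_sqrt (gammaSeq_two_pow_le (p := p) hC (by omega : 1 ≤ k + 1))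
    rw [Real.sqrt_sq (by positivity)] at h
    calc _ ≤ (2 : ℝ) ^ (k + 1) * (1 / 4) ^ (k + 1) := by gcongr
      _ = 1 / 2 * (1 / 2) ^ k := by rw [← mul_pow, pow_succ']; norm_num
  have hgeo : HasSum (fun k : ℕ => (1 / 2 : ℝ) * (1 / 2) ^ k) 1 := by
    have := hasSum_geometric_two.mul_left (1 / 2)
    norm_num at this ⊢
    exact this
  have hsum := Summable.of_nonneg_of_le (fun k => by positivity) hbound hgeo.summable
  have hhalf : Tendsto (fun k : ℕ => (1 / 2 : ℝ) ^ k) atTop (𝓝 0) :=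
    tendsto_pow_atTop_nhds_zero_of_lt_one (by norm_num) (by norm_num)
  refine hd.dynamics hp (antitoneOn_gammaSeq_two_pow hC) hsum
    ((hsum.tsum_le_tsum hbound hgeo.summable).trans hgeo.tsum_eq.le) ?_ ?_ ?_ T hT
  · have : ∀ k : ℕ, (((2 ^ (C * k ^ 2) : ℤ) : ℝ) / ((2 ^ (C * k ^ 2 + 1) : ℕ) : ℝ)) = 1 / 2 := by
      intro k
      push_cast
      rw [pow_succ (2 : ℝ) (C * k ^ 2)]
      field_simp
    simp only [this]
    rw [limsup_const]
    exact_mod_cast (by norm_num : (1 / 2 : ℝ) < 1)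
  · refine squeeze_zero (fun k => by positivity) (fun k => ?_) hhalf
    push_cast
    refine two_pow_div_two_pow_le ?_
    nlinarith
  · refine squeeze_zero (fun k => by positivity) (fun k => ?_) hhalf
    push_cast
    refine two_pow_div_two_pow_le ?_
    have h1 : k ≤ k ^ 2 := Nat.le_self_pow two_ne_zero k
    have h2 : k ^ 2 ≤ C * k ^ 2 := Nat.le_mul_of_pos_left _ (by omega)
    rw [mul_assoc]
    omega

end TwoPow

end CTypeData

/-! ### Separable Hilbert spaces -/

/-- A separable Hilbert space of infinite dimension has a Hilbert basis indexed by `ℕ`. -/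
theorem exists_hilbertBasis_nat (H : Type*) [NormedAddCommGroup H] [InnerProductSpace ℂ H]
    [CompleteSpace H] [TopologicalSpace.SeparableSpace H] (hH : ¬ FiniteDimensional ℂ H) :
    Nonempty (HilbertBasis ℕ ℂ H) := by
  obtain ⟨w, b, hb⟩ := exists_hilbertBasis ℂ H
  have ho := b.orthonormal
  have hcount : w.Countable := by
    have hdisj : w.PairwiseDisjoint fun x => Metric.ball x (1 / 2) := by
      intro x hx y hy hxy
      refine Metric.ball_disjoint_ball ?_
      have h1 : ‖x - y‖ ^ 2 = 2 := by
        have hxn : ‖x‖ = 1 := by simpa [hb] using ho.1 ⟨x, hx⟩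
        have hyn : ‖y‖ = 1 := by simpa [hb] using ho.1 ⟨y, hy⟩
        have hin : inner ℂ x y = 0 := by
          simpa [hb] using ho.2 (i := ⟨x, hx⟩) (j := ⟨y, hy⟩) (by simpa using hxy)
        rw [norm_sub_sq (𝕜 := ℂ), hin, hxn, hyn]
        norm_num
      rw [dist_eq_norm]
      nlinarith [norm_nonneg (x - y)]
    exact hdisj.countable_of_isOpen (fun x _ => Metric.isOpen_ball)
      fun x _ => ⟨x, Metric.mem_ball_self (by norm_num)⟩
  have hinf : Infinite w := by
    by_contra hfin
    rw [not_infinite_iff_finite] at hfin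
    have : FiniteDimensional ℂ (Submodule.span ℂ (Set.range b)) :=
      FiniteDimensional.span_of_finite ℂ (Set.finite_range b)
    have h1 := b.dense_span
    rw [(Submodule.closed_of_finiteDimensional _).submodule_topologicalClosure_eq] at h1
    rw [h1] at this
    exact hH (Module.Finite.equiv (Submodule.topEquiv (R := ℂ) (M := H)))
  have : Countable w := hcount.to_subtype
  obtain ⟨e⟩ := nonempty_equiv_of_countable (α := ℕ) (β := w)
  refine ⟨HilbertBasis.mk (v := b ∘ e) (ho.comp e e.injective) ?_⟩
  rw [e.surjective.range_comp, b.dense_span]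

theorem theorem58 :
    (∀ (p : ℝ≥0∞) [Fact (1 ≤ p)], p ≠ ∞ →
      ∀ (d : CTypeData) (τ : ℕ → ℤ) (δ Δ : ℕ → ℕ),
        d.IsCPlus2Type τ δ Δ →
        AntitoneOn (gammaSeq p τ δ Δ) (Set.Ici 1) →
        Summable (fun k : ℕ => (2 : ℝ) ^ (k + 1) * √(gammaSeq p τ δ Δ (k + 1))) →
        ∑' k : ℕ, (2 : ℝ) ^ (k + 1) * √(gammaSeq p τ δ Δ (k + 1)) ≤ 1 →
        limsup (fun k : ℕ => (((τ k : ℝ) / (δ k : ℝ) : ℝ) : EReal)) atTop < 1 →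
        Tendsto (fun k : ℕ => (δ k : ℝ) / (δ (k + 1) : ℝ)) atTop (𝓝 0) →
        Tendsto (fun k : ℕ => (δ k : ℝ) / (Δ k : ℝ)) atTop (𝓝 0) →
        (∃! T : lp (fun _ : ℕ => ℂ) p →L[ℂ] lp (fun _ : ℕ => ℂ) p, d.IsOperator p T) ∧
        ∀ T : lp (fun _ : ℕ => ℂ) p →L[ℂ] lp (fun _ : ℕ => ℂ) p, d.IsOperator p T →
          IsChaotic T ∧ IsUFrequentlyHypercyclic T ∧ ¬ IsFrequentlyHypercyclic T) ∧
    (∃ C₀ : ℕ, ∀ C : ℕ, C₀ ≤ C →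
      (∃ d : CTypeData, d.IsCPlus2Type (fun k => 2 ^ (C * k ^ 2))
        (fun k => 2 ^ (C * k ^ 2 + 1)) (fun k => 2 ^ (2 * C * k ^ 2 + 4))) ∧
      ∀ (p : ℝ≥0∞) [Fact (1 ≤ p)], p ≠ ∞ →
        ∀ d : CTypeData, d.IsCPlus2Type (fun k => 2 ^ (C * k ^ 2))
            (fun k => 2 ^ (C * k ^ 2 + 1)) (fun k => 2 ^ (2 * C * k ^ 2 + 4)) →
          (∃! T : lp (fun _ : ℕ => ℂ) p →L[ℂ] lp (fun _ : ℕ => ℂ) p, d.IsOperator p T) ∧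
          ∀ T : lp (fun _ : ℕ => ℂ) p →L[ℂ] lp (fun _ : ℕ => ℂ) p, d.IsOperator p T →
            IsChaotic T ∧ IsUFrequentlyHypercyclic T ∧ ¬ IsFrequentlyHypercyclic T) ∧
    (∀ (H : Type*) [NormedAddCommGroup H] [InnerProductSpace ℂ H] [CompleteSpace H]
      [TopologicalSpace.SeparableSpace H], ¬ FiniteDimensional ℂ H →
      ∃ T : H →L[ℂ] H,
        IsChaotic T ∧ IsUFrequentlyHypercyclic T ∧ ¬ IsFrequentlyHypercyclic T) := by
  refine ⟨?_, ⟨6, fun C hC => ⟨CTypeData.exists_isCPlus2Type_two_pow hC, ?_⟩⟩, ?_⟩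
  · intro p _ hp d τ δ Δ hd hanti hsum hle hτδ hδδ hδΔ
    exact ⟨d.existsUnique_isOperator hp,
      fun T hT => hd.dynamics hp hanti hsum hle hτδ hδδ hδΔ T hT⟩
  · intro p _ hp d hd
    exact ⟨d.existsUnique_isOperator hp, fun T hT => hd.dynamics_two_pow hp hC T hT⟩
  · intro H _ _ _ _ hH
    obtain ⟨B⟩ := exists_hilbertBasis_nat H hH
    obtain ⟨d, hd⟩ := CTypeData.exists_isCPlus2Type_two_pow (C := 6) le_rfl
    obtain ⟨T, hT⟩ := d.exists_isOperator (p := 2) ENNReal.ofNat_ne_top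
    obtain ⟨h1, h2, h3⟩ := hd.dynamics_two_pow ENNReal.ofNat_ne_top le_rfl T hT
    have e := B.repr.toContinuousLinearEquiv.symm
    exact ⟨_, h1.conj e, h2.conj e, fun h => h3 (h.of_conj e)⟩
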